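/- Theorem 2.4 (noncommutative Nevanlinna–Pick theorem). Let $n$ be a cardinal number with $1\le n\le\aleph_0$, let $\mathbb C^n$ be the $n$-dimensional Hilbert space (that is, $\ell^2$ if $n=\aleph_0$) with orthonormal basis $e_1,e_2,\dots$ and scalar product $\langle\lambda,\mu\rangle=\sum_m\lambda_m\overline{\mu_m}$, and let $\mathbb B_n$ be its open unit ball. Let $\mathbb F_n^+$ be the unital free semigroup on generators $g_1,g_2,\dots$ ($n$ of them), and let $\mathcal F^2=\bigoplus_{m\ge0}(\mathbb C^n)^{\otimes m}$ be the full Fock space, with its orthonormal basis $e_\alpha=e_{i_1}\otimes\cdots\otimes e_{i_m}$, $\alpha=g_{i_1}\cdots g_{i_m}\in\mathbb F_n^+$ (and $e_\alpha=1$ for the identity $\alpha$). Let $S_i\psi=e_i\otimes\psi$ be the left creation operators on $\mathcal F^2$, let $\mathcal A_n$ be the norm-closed algebra generated by the $S_i$ and the identity, and let $F^\infty\subset B(\mathcal F^2)$ be the closure of $\mathcal A_n$ in the weak operator topology. For $\phi\in F^\infty$ write $\phi\,1=\sum_\alpha a_\alpha e_\alpha$, and for $\zeta\in\mathbb B_n$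 put $\phi(\zeta)=\sum_\alpha a_\alpha\zeta_\alpha$, where $\zeta_\alpha=\zeta_{i_1}\cdots\zeta_{i_m}$ for $\alpha=g_{i_1}\cdots g_{i_m}$ (and $\zeta_\alpha=1$ for the identity $\alpha$). Let $\mathcal K$ be a complex Hilbert space of dimension $\gamma$ with a fixed orthonormal basis indexed by a set $I$, and let $M_\gamma(F^\infty)$ be the set of bounded operators $\Phi=[\phi_{ab}]_{a,b\in I}$ on $\bigoplus_{a\in I}\mathcal F^2$ all of whose matrix entries $\phi_{ab}$ belong to $F^\infty$. For $\zeta\in\mathbb B_n$, $\Phi(\zeta)$ denotes the operator on $\mathcal K$ whose matrix with respect to the fixed basis is $[\phi_{ab}(\zeta)]_{a,b\in I}$. Let $\lambda_1,\dots,\lambda_k$ be distinct points of $\mathbb B_n$ and let $W_1,\dots,W_k\in B(\mathcal K)$. Then there is $\Phi\in M_\gamma(F^\infty)$ with $\|\Phi\|\le1$ and $\Phi(\lambda_j)=W_j$ for $j=1,\dots,k$ if and only if the operator matrix with entry $$\frac{I_{\mathcal K}-W_jW_i^*}{1-\langle\lambda_j,\lambda_i\rangle}$$ in row $j$ and column $i$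 $(i,j=1,\dots,k)$ is a positive (semidefinite) operator on $\mathcal K^k$. -/

import Mathlib

noncomputable section

namespace NCPick

/-- The `n`-dimensional Hilbert space `ℂⁿ`, where `n` is the cardinality of `ι`: square-summable
families of complex numbers with the Euclidean norm (all families, if `ι` is finite). -/
abbrev CSpace (ι : Type*) : Type _ := lp (fun _ : ι => ℂ) 2

/-- The full Fock space over `ℂⁿ`, realized on its orthonormal basis `e_α`, where `α` runs through
the unital free semigroup generated by `ι`; here `e_α = e_{i₁} ⊗ ⋯ ⊗ e_{iₖ}` for
`α = i₁ ⋯ iₖ`. -/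
abbrev FockSpace (ι : Type*) : Type _ := lp (fun _ : FreeMonoid ι => ℂ) 2

/-- The basis vector `e_α` of the Fock space. -/
def FockSpace.basisVec {ι : Type*} (α : FreeMonoid ι) : FockSpace ι :=
  open Classical in lp.single 2 α (1 : ℂ)

theorem FockSpace.orthonormal_basisVec (ι : Type*) :
    Orthonormal ℂ (FockSpace.basisVec : FreeMonoid ι → FockSpace ι) := by
  classical
  rw [orthonormal_iff_ite]
  intro α β
  simp only [FockSpace.basisVec]
  rw [lp.inner_single_left, lp.single_apply, Pi.single_apply]
  split_ifs <;> simp_all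

theorem FockSpace.orthonormal_basisVec_mul {ι : Type*} (i : ι) :
    Orthonormal ℂ (fun α : FreeMonoid ι => FockSpace.basisVec (FreeMonoid.of i * α)) :=
  (FockSpace.orthonormal_basisVec ι).comp _ (fun _ _ h => by simpa using h)

/-- The left creation operator `S_i ψ = e_i ⊗ ψ`: the isometry of the Fock space with
`S_i e_α = e_{iα}`. -/
def creation {ι : Type*} (i : ι) : FockSpace ι →L[ℂ] FockSpace ι :=
  ((FockSpace.orthonormal_basisVec_mul i).orthogonalFamily.linearIsometry).toContinuousLinearMap

theorem creation_basisVec {ι : Type*} (i : ι) (α : FreeMonoid ι) :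
    creation i (FockSpace.basisVec α) = FockSpace.basisVec (FreeMonoid.of i * α) := by
  classical
  have h := (FockSpace.orthonormal_basisVec_mul i).orthogonalFamily.linearIsometry_apply_single
    (i := α) (1 : ℂ)
  simp only [creation, FockSpace.basisVec, LinearIsometry.coe_toContinuousLinearMap] at h ⊢
  convert h using 1
  simp

/-- The noncommutative disc algebra: the norm closure of the algebra generated by the
creation operators and the identity. -/
def discAlgebra (ι : Type*) : Subalgebra ℂ (FockSpace ι →L[ℂ] FockSpace ι) :=
  (Algebra.adjoin ℂ (Set.range (creation (ι := ι)))).topologicalClosure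

/-- The noncommutative analytic Toeplitz algebra `F^∞`: the closure of the noncommutative disc
algebra in the weak operator topology. -/
def toeplitzAlgebra (ι : Type*) : Set (FockSpace ι →L[ℂ] FockSpace ι) :=
  {A | ContinuousLinearMap.WOTofCLM A ∈
    closure (ContinuousLinearMap.WOTofCLM '' (discAlgebra ι : Set (FockSpace ι →L[ℂ] FockSpace ι)))}

/-- The Hilbert space direct sum `⊕_{a ∈ I} H` of copies of `H`. -/
abbrev Ampliation (I H : Type*) [NormedAddCommGroup H] : Type _ := lp (fun _ : I => H) 2

/-- The entry `X_{ab}` of an operator `X` on `⊕_I H` in its representation as a matrix of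
operators on `H`. -/
def entry {I H : Type*} [NormedAddCommGroup H] [InnerProductSpace ℂ H]
    (X : Ampliation I H →L[ℂ] Ampliation I H) (a b : I) : H →L[ℂ] H :=
  open Classical in
  (lp.evalCLM ℂ (fun _ : I => H) 2 a) ∘L X ∘L (lp.singleContinuousLinearMap ℂ (fun _ : I => H) 2 b)

/-- The bounded operators on `⊕_I H` all of whose matrix entries belong to `U`. -/
def matrixOver (I : Type*) {H : Type*} [NormedAddCommGroup H] [InnerProductSpace ℂ H]
    (U : Set (H →L[ℂ] H)) : Set (Ampliation I H →L[ℂ] Ampliation I H) :=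
  {X | ∀ a b, entry X a b ∈ U}

/-- The monomial `ζ_α = ζ_{i₁} ⋯ ζ_{iₖ}` for `α = i₁ ⋯ iₖ`. -/
def monomialAt {ι : Type*} (ζ : CSpace ι) (α : FreeMonoid ι) : ℂ :=
  FreeMonoid.lift (fun i => ζ i) α

/-- `φ(ζ) = w` for `φ = φ(S) ∈ F^∞` and a point `ζ` of the ball. The element `φ(S)` is identified
with the vector `φ = φ(S) 1 = ∑_α a_α e_α` of the Fock space, and `φ(ζ) = ∑_α a_α ζ_α`. -/
def HasValueAt {ι : Type*} (A : FockSpace ι →L[ℂ] FockSpace ι) (ζ : CSpace ι) (w : ℂ) : Prop :=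
  HasSum (fun α : FreeMonoid ι => A (FockSpace.basisVec 1) α * monomialAt ζ α) w

/-- `Φ(ζ) = W` for `Φ = [φ_{ab}]` in `M_γ(F^∞)`: the matrix of the operator `W` on `K` with
respect to the orthonormal basis `e` of `K` is `[φ_{ab}(ζ)]`. -/
def HasOperatorValueAt {ι I K : Type*} [NormedAddCommGroup K] [InnerProductSpace ℂ K]
    (e : HilbertBasis I ℂ K) (Φ : Ampliation I (FockSpace ι) →L[ℂ] Ampliation I (FockSpace ι))
    (ζ : CSpace ι) (W : K →L[ℂ] K) : Prop :=
  ∀ a b : I, HasValueAt (entry Φ a b) ζ (inner ℂ (e a) (W (e b)))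

/-- The operator on the Hilbert space `K^k` given by a `k × k` matrix of operators on `K`. -/
def blockOperator {k : ℕ} {K : Type*} [NormedAddCommGroup K] [InnerProductSpace ℂ K]
    (M : Matrix (Fin k) (Fin k) (K →L[ℂ] K)) :
    PiLp 2 (fun _ : Fin k => K) →L[ℂ] PiLp 2 (fun _ : Fin k => K) :=
  ((PiLp.continuousLinearEquiv 2 ℂ (fun _ : Fin k => K)).symm :
      (Fin k → K) →L[ℂ] PiLp 2 (fun _ : Fin k => K)) ∘L
    ContinuousLinearMap.pi fun r => ∑ c, M r c ∘L PiLp.proj 2 (fun _ : Fin k => K) c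

/-- The Pick matrix, with `(I - W_j W_i^*) / (1 - ⟨λ_j, λ_i⟩)` in row `j` and column `i`. The
scalar product `⟨λ_j, λ_i⟩ = ∑ λ_{jm} conj(λ_{im})` is linear in its first argument, whereas
`inner` is linear in the second one. -/
def pickMatrix {ι K : Type*} [NormedAddCommGroup K] [InnerProductSpace ℂ K] [CompleteSpace K]
    {k : ℕ} (lam : Fin k → CSpace ι) (W : Fin k → (K →L[ℂ] K)) :
    Matrix (Fin k) (Fin k) (K →L[ℂ] K) :=
  Matrix.of fun j i =>
    (1 - inner ℂ (lam i) (lam j) : ℂ)⁻¹ •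
      (ContinuousLinearMap.id ℂ K - W j ∘L ContinuousLinearMap.adjoint (W i))

end NCPick

end

/-! Necessity. Evaluation at `ζ` is the inner product with the kernel vector `kernelVec ζ`, which is
an eigenvector of the adjoint of every element of `F^∞` (`inner_kernelVec_apply_of_mem`). Hence `Φ*`
sends `h ⊗ kernelVec (lam i)` to `(W i)* h ⊗ kernelVec (lam i)`. Summing the Gram matrix of kernel
vectors as a geometric series over words (`inner_kernelVec`) gives exactly the Pick denominators, so
the Pick form at `x` is `‖v‖² - ‖Φ* v‖²` with `v = ∑ x_i ⊗ kernelVec (lam i)`, and this is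
nonnegative when `‖Φ‖ ≤ 1`.

Sufficiency is a lurking-isometry argument. Factoring the Pick operator through its square root
gives maps `θ i` for which the families `(conj λ_i ⊗ θ_i h, h)` and `(θ_i h, W_i* h)` have the same
Gram matrix. So some contraction carries the first to the second, and its adjoint `T` is a
colligation (`exists_colligation`). Running `T` along the tree of words turns an input signal in
`ℓ²(𝔽⁺, K)` into an output signal; the energy balance makes this a contraction (`norm_transfer_le`),
and summing the relation for `T*` over the tree shows that it takes the prescribed values
(`hasSum_output`).

Membership in `F^∞` is obtained without a commutant theorem. The operator is a convolution; damping
each letter by `r < 1` makes its entries norm-convergent series in the creation operators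
(`mem_discAlgebra`), and letting `r → 1` gives a limit in the weak operator topology
(`multiplier_mem`). -/

noncomputable section

namespace NCPick

open Finset FreeMonoid ComplexConjugate

/-! ### Sums over the tree of words -/

/-- The finset of all right factors of the words in `T`. -/
def suffixClosure {ι : Type*} (T : Finset (FreeMonoid ι)) : Finset (FreeMonoid ι) :=
  open Classical in T.biUnion fun w => ((toList w).tails.map ofList).toFinset

theorem mem_suffixClosure {ι : Type*} {T : Finset (FreeMonoid ι)} {v : FreeMonoid ι} :
    v ∈ suffixClosure T ↔ ∃ w ∈ T, toList v <:+ toList w := by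
  classical
  simp only [suffixClosure, mem_biUnion, List.mem_toFinset, List.mem_map, List.mem_tails]
  constructor
  · rintro ⟨w, hw, l, hl, rfl⟩
    exact ⟨w, hw, hl⟩
  · rintro ⟨w, hw, hl⟩
    exact ⟨w, hw, toList v, hl, rfl⟩

theorem subset_suffixClosure {ι : Type*} (T : Finset (FreeMonoid ι)) : T ⊆ suffixClosure T :=
  fun w hw => mem_suffixClosure.2 ⟨w, hw, List.suffix_rfl⟩

theorem mem_suffixClosure_of_mul {ι : Type*} {T : Finset (FreeMonoid ι)} {m : ι}
    {β : FreeMonoid ι} (h : of m * β ∈ suffixClosure T) : β ∈ suffixClosure T := by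
  obtain ⟨w, hw, hβ⟩ := mem_suffixClosure.1 h
  exact mem_suffixClosure.2 ⟨w, hw, (List.suffix_cons m (toList β)).trans hβ⟩

/-- Summation of a recursive inequality on the tree of words over a finite set of words that is
closed under right factors. -/
theorem sum_suffixClosure_le {ι : Type*} (T : Finset (FreeMonoid ι)) (p d g : FreeMonoid ι → ℝ)
    (hp : ∀ w, 0 ≤ p w)
    (h : ∀ (s : Finset ι) (β : FreeMonoid ι), ∑ m ∈ s, p (of m * β) + d β ≤ g β) :
    ∑ w ∈ suffixClosure T, p w + ∑ w ∈ suffixClosure T, d w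
      ≤ p 1 + ∑ w ∈ suffixClosure T, g w := by
  classical
  set U := suffixClosure T with hU
  set s : Finset ι := U.biUnion fun w => (toList w).toFinset with hs
  -- Every nonempty word of `U` is a letter of `s` followed by a word of `U`. As `U` is finite,
  -- terms in `p` on both sides of the final bound can later be cancelled with no prior summability.
  have key : ∑ w ∈ U, p w ≤ p 1 + ∑ β ∈ U, ∑ m ∈ s, p (of m * β) := by
    rw [← sum_product']
    have hinj : Set.InjOn (fun x : FreeMonoid ι × ι => of x.2 * x.1)
        ((U ×ˢ s : Finset (FreeMonoid ι × ι)) : Set (FreeMonoid ι × ι)) := by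
      rintro ⟨β, m⟩ - ⟨β', m'⟩ - hxy
      have : m :: toList β = m' :: toList β' := hxy
      simp only [List.cons.injEq] at this
      exact Prod.ext this.2 this.1
    rw [← sum_image (f := p) hinj, ← sum_singleton (f := p) (a := 1),
      ← sum_union]
    · refine sum_le_sum_of_subset_of_nonneg ?_ fun w _ _ => hp w
      intro w hw
      induction w using FreeMonoid.casesOn with
      | one => simp
      | of_mul m β =>
        refine mem_union_right _ (mem_image.2 ⟨(β, m), ?_, rfl⟩)
        refine mem_product.2 ⟨mem_suffixClosure_of_mul hw, mem_biUnion.2 ⟨_, hw, ?_⟩⟩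
        simp
    · rw [disjoint_singleton_left]
      intro hmem
      obtain ⟨x, -, hx⟩ := mem_image.1 hmem
      have : x.2 :: toList x.1 = [] := hx
      simp at this
  have h2 := sum_le_sum fun β (_ : β ∈ U) => h s β
  rw [sum_add_distrib] at h2
  linarith

/-- Splitting off the first letter in a sum over all words. -/
theorem hasSum_freeMonoid {ι E : Type*} [NormedAddCommGroup E] {f : FreeMonoid ι → E}
    {a : E} (h : HasSum (fun x : ι × FreeMonoid ι => f (of x.1 * x.2)) a) :
    HasSum f (f 1 + a) := by
  let ev : Option (ι × FreeMonoid ι) ≃ FreeMonoid ι :=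
    { toFun := fun o => o.elim 1 fun x => of x.1 * x.2
      invFun := fun w => FreeMonoid.casesOn w none fun m β => some (m, β)
      left_inv := by
        rintro (_ | ⟨m, β⟩)
        · rfl
        · rfl
      right_inv := by
        intro w
        induction w using FreeMonoid.casesOn with
        | one => rfl
        | of_mul m β => rfl }
  rw [← ev.hasSum_iff]
  have h1 : HasSum (fun o : Option (ι × FreeMonoid ι) => o.elim 0 fun x => f (of x.1 * x.2)) a := by
    refine (Function.Injective.hasSum_iff (Option.some_injective (ι × FreeMonoid ι)) ?_).1 h
    rintro (_ | x) hx
    · rfl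
    · exact absurd ⟨x, rfl⟩ hx
  have h2 : HasSum (fun o : Option (ι × FreeMonoid ι) => o.elim (f 1) fun _ => 0) (f 1) := by
    refine hasSum_single (f := fun o : Option (ι × FreeMonoid ι) => o.elim (f 1) fun _ => 0)
      none ?_
    rintro (_ | x) hx
    · exact absurd rfl hx
    · rfl
  refine (h2.add h1).congr_fun ?_
  rintro (_ | x)
  · simp [ev]
  · simp [ev]

theorem summable_freeMonoid_cons {ι E : Type*} [NormedAddCommGroup E] [CompleteSpace E]
    {f : FreeMonoid ι → E} (h : Summable f) :
    Summable fun x : ι × FreeMonoid ι => f (of x.1 * x.2) := by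
  refine h.comp_injective (i := fun x : ι × FreeMonoid ι => of x.1 * x.2) ?_
  rintro ⟨m, β⟩ ⟨m', β'⟩ hxy
  have : m :: toList β = m' :: toList β' := hxy
  simp only [List.cons.injEq] at this
  exact Prod.ext this.1 this.2

theorem tsum_freeMonoid {ι E : Type*} [NormedAddCommGroup E] [CompleteSpace E]
    {f : FreeMonoid ι → E} (h : Summable f) :
    ∑' w, f w = f 1 + ∑' x : ι × FreeMonoid ι, f (of x.1 * x.2) :=
  (hasSum_freeMonoid (summable_freeMonoid_cons h).hasSum).tsum_eq

/-! ### Elementary tensors -/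

section tens

variable {X H : Type*} [NormedAddCommGroup H] [InnerProductSpace ℂ H]

theorem memℓp_smul_const (z : lp (fun _ : X => ℂ) 2) (v : H) :
    Memℓp (fun m => z m • v : X → H) 2 := by
  have h := (lp.memℓp z).summable (by norm_num)
  refine memℓp_gen ?_
  have h' := h.mul_right (‖v‖ ^ (2 : ENNReal).toReal)
  refine h'.congr fun m => ?_
  rw [norm_smul, Real.mul_rpow (norm_nonneg _) (norm_nonneg _)]

/-- The elementary tensor `z ⊗ v`, as an element of the Hilbert sum of copies of `H`. -/
def tens (z : lp (fun _ : X => ℂ) 2) (v : H) : lp (fun _ : X => H) 2 :=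
  ⟨fun m => z m • v, memℓp_smul_const z v⟩

@[simp] theorem tens_apply (z : lp (fun _ : X => ℂ) 2) (v : H) (m : X) : tens z v m = z m • v := rfl

theorem tens_add_left (z z' : lp (fun _ : X => ℂ) 2) (v : H) :
    tens (z + z') v = tens z v + tens z' v := by
  ext m; simp [add_smul]

theorem tens_smul_left (c : ℂ) (z : lp (fun _ : X => ℂ) 2) (v : H) :
    tens (c • z) v = c • tens z v := by
  ext m; simp [mul_smul]

theorem tens_add_right (z : lp (fun _ : X => ℂ) 2) (v v' : H) :
    tens z (v + v') = tens z v + tens z v' := by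
  ext m; simp

theorem tens_smul_right (c : ℂ) (z : lp (fun _ : X => ℂ) 2) (v : H) :
    tens z (c • v) = c • tens z v := by
  ext m; simp [smul_comm c]

theorem inner_tens (z z' : lp (fun _ : X => ℂ) 2) (v v' : H) :
    inner ℂ (tens z v) (tens z' v') = inner ℂ z z' * inner ℂ v v' := by
  rw [lp.inner_eq_tsum, lp.inner_eq_tsum, ← tsum_mul_right]
  refine tsum_congr fun m => ?_
  simp only [tens_apply, inner_smul_left, inner_smul_right, RCLike.inner_apply]
  ring

theorem norm_tens (z : lp (fun _ : X => ℂ) 2) (v : H) : ‖tens z v‖ = ‖z‖ * ‖v‖ := by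
  have h := inner_tens z z v v
  simp only [inner_self_eq_norm_sq_to_K] at h
  have hsq : ‖tens z v‖ ^ 2 = ‖z‖ ^ 2 * ‖v‖ ^ 2 := by exact_mod_cast h
  rw [← mul_pow] at hsq
  exact (pow_left_inj₀ (norm_nonneg _) (by positivity) two_ne_zero).1 hsq

/-- `v ↦ z ⊗ v` as a bounded operator. -/
def tensLeft (z : lp (fun _ : X => ℂ) 2) : H →L[ℂ] lp (fun _ : X => H) 2 :=
  LinearMap.mkContinuous
    { toFun := tens z, map_add' := tens_add_right z, map_smul' := fun c v => tens_smul_right c z v }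
    ‖z‖ fun v => (norm_tens z v).le

/-- `z ↦ z ⊗ v` as a bounded operator. -/
def tensRight (v : H) : lp (fun _ : X => ℂ) 2 →L[ℂ] lp (fun _ : X => H) 2 :=
  LinearMap.mkContinuous
    { toFun := fun z => tens z v, map_add' := fun z z' => tens_add_left z z' v,
      map_smul' := fun c z => tens_smul_left c z v }
    ‖v‖ fun z => by rw [mul_comm]; exact (norm_tens z v).le

@[simp] theorem tensRight_apply (z : lp (fun _ : X => ℂ) 2) (v : H) :
    tensRight v z = tens z v := rfl

theorem tens_single [DecidableEq X] (m : X) (v : H) :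
    tens (lp.single 2 m (1 : ℂ)) v = lp.single 2 m v := by
  ext l
  by_cases h : l = m
  · subst h; simp
  · simp [h]

end tens

/-! ### Kernel vectors -/

section kernel

variable {ι : Type*}

@[simp] theorem monomialAt_one (ζ : CSpace ι) : monomialAt ζ 1 = 1 := by simp [monomialAt]

@[simp] theorem monomialAt_of_mul (ζ : CSpace ι) (m : ι) (β : FreeMonoid ι) :
    monomialAt ζ (of m * β) = ζ m * monomialAt ζ β := by simp [monomialAt]

theorem sum_norm_sq_le_norm_sq {X : Type*} {G : X → Type*} [∀ i, NormedAddCommGroup (G i)]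
    (f : lp G 2) (s : Finset X) : ∑ m ∈ s, ‖f m‖ ^ 2 ≤ ‖f‖ ^ 2 := by
  have := lp.sum_rpow_le_norm_rpow (p := 2) (by norm_num) f s
  simpa using this

theorem summable_norm_sq {X : Type*} {G : X → Type*} [∀ i, NormedAddCommGroup (G i)]
    (f : lp G 2) : Summable fun m => ‖f m‖ ^ 2 := by
  have := (lp.memℓp f).summable (by norm_num)
  simpa using this

/-- The words of length `n` contribute `(c‖ζ‖²)^n`. Kernel vectors need only `c = 1`; a value `c >
1` is what lets monomials be paired with states that do not decay. -/
theorem summable_norm_monomialAt_sq_mul {ζ : CSpace ι} {c : ℝ} (hc : 0 ≤ c)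
    (hζ : c * ‖ζ‖ ^ 2 < 1) :
    Summable fun w : FreeMonoid ι => c ^ w.length * ‖monomialAt ζ w‖ ^ 2 := by
  refine summable_of_sum_le (c := (1 - c * ‖ζ‖ ^ 2)⁻¹) (fun w => by positivity) fun T => ?_
  have h := sum_suffixClosure_le T (fun w => c ^ w.length * ‖monomialAt ζ w‖ ^ 2) (fun _ => 0)
    (fun w => c * ‖ζ‖ ^ 2 * (c ^ w.length * ‖monomialAt ζ w‖ ^ 2)) (fun w => by positivity)
    (fun s β => by
      have : ∀ m, c ^ (of m * β).length * ‖monomialAt ζ (of m * β)‖ ^ 2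
          = ‖ζ m‖ ^ 2 * (c * (c ^ β.length * ‖monomialAt ζ β‖ ^ 2)) := by
        intro m
        rw [monomialAt_of_mul, norm_mul, length_mul, length_of, pow_add]; ring
      simp only [this, ← sum_mul, add_zero]
      calc _ ≤ ‖ζ‖ ^ 2 * (c * (c ^ β.length * ‖monomialAt ζ β‖ ^ 2)) := by
            gcongr
            exact sum_norm_sq_le_norm_sq ζ s
        _ = _ := by ring)
  rw [← mul_sum] at h
  simp only [sum_const_zero, add_zero, monomialAt_one, length_one, pow_zero, norm_one, one_pow,
    mul_one] at h
  have h1 : 0 < 1 - c * ‖ζ‖ ^ 2 := by linarith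
  refine (sum_le_sum_of_subset_of_nonneg (subset_suffixClosure T)
    fun w _ _ => by positivity).trans ?_
  rw [← one_div, le_div_iff₀ h1]
  linarith

theorem norm_sq_lt_one {ζ : CSpace ι} (hζ : ζ ∈ Metric.ball 0 1) : ‖ζ‖ ^ 2 < 1 := by
  have : ‖ζ‖ < 1 := by simpa using hζ
  nlinarith [norm_nonneg ζ]

theorem memℓp_monomialAt {ζ : CSpace ι} (hζ : ζ ∈ Metric.ball 0 1) :
    Memℓp (fun w => conj (monomialAt ζ w) : FreeMonoid ι → ℂ) 2 := by
  refine memℓp_gen ?_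
  have := summable_norm_monomialAt_sq_mul (ζ := ζ) zero_le_one (by simpa using norm_sq_lt_one hζ)
  simpa using this

/-- The kernel vector at `ζ`: the vector representing the evaluation at `ζ`. -/
def kernelVec (ζ : CSpace ι) (hζ : ζ ∈ Metric.ball 0 1) : FockSpace ι :=
  ⟨fun w => conj (monomialAt ζ w), memℓp_monomialAt hζ⟩

@[simp] theorem kernelVec_apply (ζ : CSpace ι) (hζ : ζ ∈ Metric.ball 0 1) (w : FreeMonoid ι) :
    kernelVec ζ hζ w = conj (monomialAt ζ w) := rfl

theorem inner_basisVec_left (w : FreeMonoid ι) (f : FockSpace ι) :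
    inner ℂ (FockSpace.basisVec w) f = f w := by
  classical
  rw [FockSpace.basisVec, lp.inner_single_left]; simp

theorem hasSum_kernelVec (ζ : CSpace ι) (hζ : ζ ∈ Metric.ball 0 1) (f : FockSpace ι) :
    HasSum (fun w => f w * monomialAt ζ w) (inner ℂ (kernelVec ζ hζ) f) := by
  have := lp.hasSum_inner (𝕜 := ℂ) (kernelVec ζ hζ) f
  simpa [RCLike.inner_apply] using this

theorem hasValueAt_iff (A : FockSpace ι →L[ℂ] FockSpace ι) (ζ : CSpace ι)
    (hζ : ζ ∈ Metric.ball 0 1) (w : ℂ) :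
    HasValueAt A ζ w ↔ inner ℂ (kernelVec ζ hζ) (A (FockSpace.basisVec 1)) = w :=
  ⟨fun h => (hasSum_kernelVec ζ hζ _).unique h, fun h => h ▸ hasSum_kernelVec ζ hζ _⟩

theorem one_sub_inner_ne_zero {ζ ξ : CSpace ι} (hζ : ζ ∈ Metric.ball 0 1)
    (hξ : ξ ∈ Metric.ball 0 1) : (1 - inner ℂ ξ ζ : ℂ) ≠ 0 := by
  intro h
  have h1 : ‖(inner ℂ ξ ζ : ℂ)‖ = 1 := by rw [← sub_eq_zero.1 h]; simp
  have h2 := norm_inner_le_norm (𝕜 := ℂ) ξ ζ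
  have h3 : ‖ζ‖ < 1 := by simpa using hζ
  have h4 : ‖ξ‖ < 1 := by simpa using hξ
  nlinarith [norm_nonneg ζ, norm_nonneg ξ]

theorem hasSum_mul_prod {X Y : Type*} {f : X → ℂ} {g : Y → ℂ} {a b : ℂ} (hf : HasSum f a)
    (hg : HasSum g b) : HasSum (fun x : X × Y => f x.1 * g x.2) (a * b) :=
  hf.mul hg (summable_mul_of_summable_norm (f := f) (g := g) hf.summable.norm hg.summable.norm)

/-- Splitting off the first letter shows that the inner product `g` satisfies `g = 1 + ⟨ξ, ζ⟩ g`. -/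
theorem inner_kernelVec (ζ ξ : CSpace ι) (hζ : ζ ∈ Metric.ball 0 1) (hξ : ξ ∈ Metric.ball 0 1) :
    inner ℂ (kernelVec ζ hζ) (kernelVec ξ hξ) = (1 - inner ℂ ξ ζ)⁻¹ := by
  have hs := hasSum_kernelVec ζ hζ (kernelVec ξ hξ)
  have h1 := tsum_freeMonoid hs.summable
  rw [hs.tsum_eq] at h1
  have h2 : HasSum (fun x : ι × FreeMonoid ι => kernelVec ξ hξ (of x.1 * x.2)
      * monomialAt ζ (of x.1 * x.2)) (inner ℂ ξ ζ * inner ℂ (kernelVec ζ hζ) (kernelVec ξ hξ)) := by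
    have h0 := lp.hasSum_inner (𝕜 := ℂ) ξ ζ
    have h3 := hasSum_mul_prod h0 hs
    refine h3.congr_fun fun x => ?_
    simp only [kernelVec_apply, monomialAt_of_mul, map_mul, RCLike.inner_apply]
    ring
  rw [h2.tsum_eq] at h1
  simp only [kernelVec_apply, monomialAt_one, map_one, mul_one] at h1
  refine eq_inv_of_mul_eq_one_left ?_
  linear_combination h1

end kernel

end NCPick

end

/-! ### Necessity: eigenvectors of adjoints and the Pick form -/

noncomputable section

namespace NCPick

open Finset FreeMonoid ComplexConjugate ContinuousLinearMap

variable {ι : Type*}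

theorem fockSpace_ext {E : Type*} [NormedAddCommGroup E] [NormedSpace ℂ E]
    {f g : FockSpace ι →L[ℂ] E}
    (h : ∀ w, f (FockSpace.basisVec w) = g (FockSpace.basisVec w)) : f = g := by
  classical
  refine lp.ext_continuousLinearMap (by norm_num) fun w => ?_
  ext
  simpa [FockSpace.basisVec] using h w

/-- `A` acts as a scalar under the adjoint on the kernel vector at `ζ`. -/
theorem inner_kernelVec_apply_of_mem {A : FockSpace ι →L[ℂ] FockSpace ι}
    (hA : A ∈ toeplitzAlgebra ι) (ζ : CSpace ι) (hζ : ζ ∈ Metric.ball 0 1) (ψ : FockSpace ι) :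
    inner ℂ (kernelVec ζ hζ) (A ψ) =
      inner ℂ (kernelVec ζ hζ) (A (FockSpace.basisVec 1)) * inner ℂ (kernelVec ζ hζ) ψ := by
  set z := kernelVec ζ hζ with hz
  have hzb : ∀ w, inner ℂ z (FockSpace.basisVec w) = monomialAt ζ w := by
    intro w
    rw [← inner_conj_symm, inner_basisVec_left, hz, kernelVec_apply, Complex.conj_conj]
  have hS : ∀ m, (innerSL ℂ z) ∘L creation m = ζ m • innerSL ℂ z := by
    intro m
    refine fockSpace_ext fun w => ?_
    simp [creation_basisVec, hzb]
  have hadj : ∀ B ∈ Algebra.adjoin ℂ (Set.range (creation (ι := ι))),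
      ∃ c : ℂ, ∀ φ, inner ℂ z (B φ) = c * inner ℂ z φ := by
    intro B hB
    induction hB using Algebra.adjoin_induction with
    | mem B hB =>
      obtain ⟨m, rfl⟩ := hB
      exact ⟨ζ m, fun φ => by simpa using congrArg (fun f => f φ) (hS m)⟩
    | algebraMap c =>
      exact ⟨c, fun φ => by simp [Algebra.algebraMap_eq_smul_one]⟩
    | add B C _ _ hB hC =>
      obtain ⟨b, hb⟩ := hB
      obtain ⟨c, hc⟩ := hC
      exact ⟨b + c, fun φ => by simp [hb, hc, add_mul]⟩
    | mul B C _ _ hB hC =>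
      obtain ⟨b, hb⟩ := hB
      obtain ⟨c, hc⟩ := hC
      exact ⟨b * c, fun φ => by simp [hb, hc, mul_assoc]⟩
  -- Writing the scalar as `⟨z, B 1⟩` removes the existential quantifier, so the eigenvector
  -- relation becomes a closed condition on `B` in the weak operator topology.
  let P : Set (FockSpace ι →WOT[ℂ] FockSpace ι) :=
    {B | innerSL ℂ z (B ψ) = innerSL ℂ z (B (FockSpace.basisVec 1)) * inner ℂ z ψ}
  have hP : IsClosed P := isClosed_eq (ContinuousLinearMapWOT.continuous_dual_apply _ _)
    ((ContinuousLinearMapWOT.continuous_dual_apply _ _).mul continuous_const)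
  have hdisc : WOTofCLM '' (discAlgebra ι : Set (FockSpace ι →L[ℂ] FockSpace ι)) ⊆ P := by
    rw [Set.image_subset_iff]
    refine closure_minimal ?_ (hP.preimage WOTofCLM.continuous)
    intro B hB
    obtain ⟨c, hc⟩ := hadj B hB
    change innerSL ℂ z (B ψ) = innerSL ℂ z (B (FockSpace.basisVec 1)) * inner ℂ z ψ
    simp [hc, hzb]
  exact closure_minimal hdisc hP hA

section pick

variable {K : Type*} [NormedAddCommGroup K] [InnerProductSpace ℂ K]

theorem inner_blockOperator_pickMatrix [CompleteSpace K] {k : ℕ}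
    (lam : Fin k → CSpace ι) (W : Fin k → (K →L[ℂ] K))
    (x y : PiLp 2 (fun _ : Fin k => K)) :
    inner ℂ (blockOperator (pickMatrix lam W) x) y =
      ∑ j, ∑ i, (1 - inner ℂ (lam j) (lam i))⁻¹ *
        (inner ℂ (x i) (y j) - inner ℂ (adjoint (W i) (x i)) (adjoint (W j) (y j))) := by
  rw [PiLp.inner_apply]
  refine sum_congr rfl fun j _ => ?_
  have : (blockOperator (pickMatrix lam W) x) j =
      ∑ i, (1 - inner ℂ (lam i) (lam j) : ℂ)⁻¹ • (x i - W j (adjoint (W i) (x i))) := by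
    simp [blockOperator, pickMatrix]
  rw [this, sum_inner]
  refine sum_congr rfl fun i _ => ?_
  -- The operator is in the conjugate-linear slot; conjugating the coefficient interchanges the two
  -- points.
  rw [inner_smul_left, inner_sub_left, adjoint_inner_right]
  simp

variable {I : Type*}

/-- The elementary tensor `h ⊗ z` in `⊕_I H`, where `h` is expanded in the basis `e`. -/
def basisTens {H : Type*} [NormedAddCommGroup H] [InnerProductSpace ℂ H]
    (e : HilbertBasis I ℂ K) (z : H) : K →L[ℂ] Ampliation I H :=
  tensRight z ∘L (e.repr.toContinuousLinearEquiv : K →L[ℂ] lp (fun _ : I => ℂ) 2)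

theorem inner_basisTens {H : Type*} [NormedAddCommGroup H] [InnerProductSpace ℂ H]
    (e : HilbertBasis I ℂ K) (z z' : H) (h h' : K) :
    inner ℂ (basisTens e z h) (basisTens e z' h') = inner ℂ h h' * inner ℂ z z' := by
  simp [basisTens, inner_tens]

theorem basisTens_basis {H : Type*} [NormedAddCommGroup H] [InnerProductSpace ℂ H] [DecidableEq I]
    (e : HilbertBasis I ℂ K) (z : H) (a : I) :
    basisTens e z (e a) = lp.single 2 a z := by
  simp [basisTens, HilbertBasis.repr_self, tens_single]

theorem inner_single_apply_single {H : Type*} [NormedAddCommGroup H] [InnerProductSpace ℂ H]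
    (X : Ampliation I H →L[ℂ] Ampliation I H) (a b : I) (f g : H) :
    open Classical in
    inner ℂ (lp.single 2 a f : Ampliation I H) (X (lp.single 2 b g)) =
      inner ℂ f (entry X a b g) := by
  classical
  rw [lp.inner_single_left]
  rfl

/-- With `J h = h ⊗ z`, the claim is the adjoint of `J* Φ = W J*`. That identity can be tested on
one column and one coordinate at a time, where it is the eigenvector relation of a single entry; no
infinite matrix product has to be summed. -/
theorem adjoint_apply_basisTens [CompleteSpace K] (e : HilbertBasis I ℂ K)
    {Φ : Ampliation I (FockSpace ι) →L[ℂ] Ampliation I (FockSpace ι)}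
    (hΦ : Φ ∈ matrixOver I (toeplitzAlgebra ι)) (ζ : CSpace ι) (hζ : ζ ∈ Metric.ball 0 1)
    {W : K →L[ℂ] K} (hW : HasOperatorValueAt e Φ ζ W) (h : K) :
    adjoint Φ (basisTens e (kernelVec ζ hζ) h) = basisTens e (kernelVec ζ hζ) (adjoint W h) := by
  classical
  set z := kernelVec ζ hζ with hz
  have key : ∀ (a b : I) (ψ : FockSpace ι),
      inner ℂ (lp.single 2 a z : Ampliation I (FockSpace ι)) (Φ (lp.single 2 b ψ)) =
        inner ℂ (e a) (W (e b)) * inner ℂ z ψ := by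
    intro a b ψ
    have h1 := inner_single_apply_single Φ a b z ψ
    rw [inner_kernelVec_apply_of_mem (hΦ a b) ζ hζ ψ,
      (hasValueAt_iff _ ζ hζ _).1 (hW a b)] at h1
    convert h1
  have hcomp : adjoint (basisTens e z) ∘L Φ = W ∘L adjoint (basisTens e z) := by
    refine lp.ext_continuousLinearMap (by norm_num) fun b => ?_
    ext ψ
    simp only [coe_comp, Function.comp_apply, lp.singleContinuousLinearMap_apply]
    have h2 : adjoint (basisTens e z) (lp.single 2 b ψ) = (inner ℂ z ψ : ℂ) • e b := by
      refine ext_inner_left ℂ fun u => ?_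
      rw [adjoint_inner_right, ← basisTens_basis e ψ b, inner_basisTens, inner_smul_right, mul_comm]
    rw [h2, map_smul]
    refine e.repr.injective (lp.ext (funext fun a => ?_))
    rw [e.repr_apply_apply, e.repr_apply_apply, adjoint_inner_right, basisTens_basis, key,
      inner_smul_right, mul_comm]
  have h3 := congrArg adjoint hcomp
  rw [adjoint_comp, adjoint_comp, adjoint_adjoint] at h3
  exact congrArg (fun f => f h) h3

theorem isPositive_of_exists [CompleteSpace K] (e : HilbertBasis I ℂ K) {k : ℕ}
    (lam : Fin k → CSpace ι) (hlam : ∀ j, lam j ∈ Metric.ball 0 1) (W : Fin k → (K →L[ℂ] K))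
    {Φ : Ampliation I (FockSpace ι) →L[ℂ] Ampliation I (FockSpace ι)}
    (hΦ : Φ ∈ matrixOver I (toeplitzAlgebra ι)) (hnorm : ‖Φ‖ ≤ 1)
    (hW : ∀ j, HasOperatorValueAt e Φ (lam j) (W j)) :
    (blockOperator (pickMatrix lam W)).IsPositive := by
  rw [isPositive_iff_complex]
  intro x
  set v : Ampliation I (FockSpace ι) :=
    ∑ i, basisTens e (kernelVec (lam i) (hlam i)) (x i) with hv
  have hΦv : adjoint Φ v =
      ∑ i, basisTens e (kernelVec (lam i) (hlam i)) (adjoint (W i) (x i)) := by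
    rw [hv, map_sum]
    exact sum_congr rfl fun i _ => adjoint_apply_basisTens e hΦ _ _ (hW i) _
  have hform : inner ℂ (blockOperator (pickMatrix lam W) x) x =
      ((‖v‖ ^ 2 - ‖adjoint Φ v‖ ^ 2 : ℝ) : ℂ) := by
    have h1 : ((‖v‖ ^ 2 - ‖adjoint Φ v‖ ^ 2 : ℝ) : ℂ) =
        inner ℂ v v - inner ℂ (adjoint Φ v) (adjoint Φ v) := by
      simp only [inner_self_eq_norm_sq_to_K]
      push_cast
      rfl
    rw [h1, hΦv, hv, inner_blockOperator_pickMatrix]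
    simp only [inner_sum, sum_inner, inner_basisTens, ← sum_sub_distrib]
    refine sum_congr rfl fun j _ => sum_congr rfl fun i _ => ?_
    rw [inner_kernelVec]
    ring
  have hle : ‖adjoint Φ v‖ ≤ ‖v‖ := by
    have h2 : ‖adjoint Φ‖ ≤ 1 := by rwa [LinearIsometryEquiv.norm_map]
    simpa using (adjoint Φ).le_of_opNorm_le h2 v
  rw [hform]
  refine ⟨by rw [RCLike.re_to_complex, Complex.ofReal_re], ?_⟩
  have : ‖adjoint Φ v‖ ^ 2 ≤ ‖v‖ ^ 2 := by gcongr
  simp only [RCLike.re_to_complex, Complex.ofReal_re]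
  linarith

end pick

end NCPick

end

/-! ### Sufficiency: colligations and their input-output operators -/

noncomputable section

namespace NCPick

open Finset FreeMonoid ComplexConjugate ContinuousLinearMap

section transfer

variable {ι H K : Type*} [NormedAddCommGroup H] [InnerProductSpace ℂ H]
  [NormedAddCommGroup K] [InnerProductSpace ℂ K]

/-- A colligation with state space `H` and external space `K`: it sends a state and an input to a
family of new states, one for each letter, and an output. -/
abbrev Colligation (ι H K : Type*) [NormedAddCommGroup H] [InnerProductSpace ℂ H]
    [NormedAddCommGroup K] [InnerProductSpace ℂ K] : Type _ :=
  WithLp 2 (H × K) →L[ℂ] WithLp 2 (lp (fun _ : ι => H) 2 × K)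

/-- The states, indexed by words, produced by the input signal `f`; new states are damped by `r`. -/
def state (T : Colligation ι H K) (r : ℝ) (f : FreeMonoid ι → K) (w : FreeMonoid ι) : H :=
  FreeMonoid.recOn w 0 fun m β x => (r : ℂ) • (T (WithLp.toLp 2 (x, f β))).fst m

/-- The output signal produced by the input signal `f`. -/
def output (T : Colligation ι H K) (r : ℝ) (f : FreeMonoid ι → K) (w : FreeMonoid ι) : K :=
  (T (WithLp.toLp 2 (state T r f w, f w))).snd

variable (T : Colligation ι H K) (r : ℝ)

@[simp] theorem state_one (f : FreeMonoid ι → K) : state T r f 1 = 0 := rfl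

theorem state_of_mul (f : FreeMonoid ι → K) (m : ι) (β : FreeMonoid ι) :
    state T r f (of m * β) = (r : ℂ) • (T (WithLp.toLp 2 (state T r f β, f β))).fst m := rfl

theorem state_add (f g : FreeMonoid ι → K) (w : FreeMonoid ι) :
    state T r (f + g) w = state T r f w + state T r g w := by
  induction w using FreeMonoid.inductionOn' with
  | one => simp
  | of_mul m β ih =>
    have : WithLp.toLp 2 (state T r (f + g) β, (f + g) β) =
        WithLp.toLp 2 (state T r f β, f β) + WithLp.toLp 2 (state T r g β, g β) := by
      rw [ih]; rfl
    rw [state_of_mul, state_of_mul, state_of_mul, this, map_add, ← smul_add]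
    rfl

theorem state_smul (c : ℂ) (f : FreeMonoid ι → K) (w : FreeMonoid ι) :
    state T r (c • f) w = c • state T r f w := by
  induction w using FreeMonoid.inductionOn' with
  | one => simp
  | of_mul m β ih =>
    have : WithLp.toLp 2 (state T r (c • f) β, (c • f) β) =
        c • WithLp.toLp 2 (state T r f β, f β) := by
      rw [ih]; rfl
    rw [state_of_mul, state_of_mul, this, map_smul, smul_comm]
    rfl

theorem output_add (f g : FreeMonoid ι → K) (w : FreeMonoid ι) :
    output T r (f + g) w = output T r f w + output T r g w := by
  have : WithLp.toLp 2 (state T r (f + g) w, (f + g) w) =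
      WithLp.toLp 2 (state T r f w, f w) + WithLp.toLp 2 (state T r g w, g w) := by
    rw [state_add]; rfl
  rw [output, this, map_add]
  rfl

theorem output_smul (c : ℂ) (f : FreeMonoid ι → K) (w : FreeMonoid ι) :
    output T r (c • f) w = c • output T r f w := by
  have : WithLp.toLp 2 (state T r (c • f) w, (c • f) w) =
      c • WithLp.toLp 2 (state T r f w, f w) := by
    rw [state_smul]; rfl
  rw [output, this, map_smul]
  rfl

variable {T r}

/-- The energy balance of a contractive colligation at a word. -/
theorem energy_le (hT : ‖T‖ ≤ 1) (hr : |r| ≤ 1) (f : FreeMonoid ι → K) (s : Finset ι)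
    (β : FreeMonoid ι) :
    ∑ m ∈ s, ‖state T r f (of m * β)‖ ^ 2 + ‖output T r f β‖ ^ 2
      ≤ ‖state T r f β‖ ^ 2 + ‖f β‖ ^ 2 := by
  set v := WithLp.toLp 2 (state T r f β, f β) with hv
  have h1 : ‖T v‖ ^ 2 ≤ ‖v‖ ^ 2 := by
    have := T.le_of_opNorm_le hT v
    rw [one_mul] at this
    gcongr
  rw [WithLp.prod_norm_sq_eq_of_L2, WithLp.prod_norm_sq_eq_of_L2 v] at h1
  refine le_trans ?_ h1
  refine add_le_add ?_ le_rfl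
  refine le_trans (sum_le_sum fun m _ => ?_) (sum_norm_sq_le_norm_sq (T v).fst s)
  rw [state_of_mul, norm_smul, Complex.norm_real, Real.norm_eq_abs, mul_pow]
  refine mul_le_of_le_one_left (by positivity) ?_
  exact pow_le_one₀ (abs_nonneg r) hr

/-- Summing the energy balance over a finite tree cancels the state energies; the state at the root
is zero, so output energy is bounded by input energy. -/
theorem sum_output_le (hT : ‖T‖ ≤ 1) (hr : |r| ≤ 1) (f : lp (fun _ : FreeMonoid ι => K) 2)
    (S : Finset (FreeMonoid ι)) : ∑ w ∈ S, ‖output T r f w‖ ^ 2 ≤ ‖f‖ ^ 2 := by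
  have h := sum_suffixClosure_le S (fun w => ‖state T r f w‖ ^ 2) (fun w => ‖output T r f w‖ ^ 2)
    (fun w => ‖state T r f w‖ ^ 2 + ‖f w‖ ^ 2) (fun w => by positivity)
    (fun s β => energy_le hT hr f s β)
  rw [sum_add_distrib] at h
  simp only [state_one, norm_zero, ne_eq, OfNat.ofNat_ne_zero, not_false_eq_true, zero_pow,
    zero_add, add_le_add_iff_left] at h
  exact (sum_le_sum_of_subset_of_nonneg (subset_suffixClosure S)
    fun w _ _ => by positivity).trans (h.trans (sum_norm_sq_le_norm_sq f _))

theorem memℓp_output (hT : ‖T‖ ≤ 1) (hr : |r| ≤ 1) (f : lp (fun _ : FreeMonoid ι => K) 2) :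
    Memℓp (output T r f) 2 := by
  refine memℓp_gen (Summable.congr (summable_of_sum_le (c := ‖f‖ ^ 2)
    (f := fun w => ‖output T r f w‖ ^ 2) (fun w => by positivity)
    fun S => sum_output_le hT hr f S) fun w => by simp)

/-- The input-output operator of a contractive colligation. -/
def transfer (hT : ‖T‖ ≤ 1) (hr : |r| ≤ 1) :
    lp (fun _ : FreeMonoid ι => K) 2 →L[ℂ] lp (fun _ : FreeMonoid ι => K) 2 :=
  LinearMap.mkContinuous
    { toFun := fun f => ⟨output T r f, memℓp_output hT hr f⟩
      map_add' := fun f g => lp.ext (funext fun w => output_add T r f g w)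
      map_smul' := fun c f => lp.ext (funext fun w => output_smul T r c f w) }
    1 fun f => by
      rw [one_mul]
      refine lp.norm_le_of_forall_sum_le (by norm_num) (norm_nonneg f) fun S => ?_
      simpa using sum_output_le hT hr f S

@[simp] theorem transfer_apply (hT : ‖T‖ ≤ 1) (hr : |r| ≤ 1)
    (f : lp (fun _ : FreeMonoid ι => K) 2) (w : FreeMonoid ι) :
    transfer hT hr f w = output T r f w := rfl

theorem norm_transfer_le (hT : ‖T‖ ≤ 1) (hr : |r| ≤ 1) : ‖transfer hT hr‖ ≤ 1 :=
  LinearMap.mkContinuous_norm_le _ zero_le_one _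

/-- Causality: the state at `w` depends only on the inputs at proper right factors of `w`. -/
theorem state_eq_zero {f : FreeMonoid ι → K} {w : FreeMonoid ι}
    (h : ∀ α v, w = α * v → α ≠ 1 → f v = 0) : state T r f w = 0 := by
  induction w using FreeMonoid.inductionOn' with
  | one => rfl
  | of_mul m β ih =>
    have h1 : state T r f β = 0 := by
      refine ih fun α v hv _ => h (of m * α) v (by rw [hv, mul_assoc]) ?_
      intro h0
      have := congrArg length h0
      simp [length_mul] at this
    have h2 : f β = 0 := h (of m) β rfl (of_ne_one m)
    have h3 : WithLp.toLp 2 ((0 : H), (0 : K)) = 0 := rfl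
    rw [state_of_mul, h1, h2, h3, map_zero]
    exact smul_zero _

theorem output_eq_zero {f : FreeMonoid ι → K} {w : FreeMonoid ι}
    (h : ∀ α v, w = α * v → f v = 0) : output T r f w = 0 := by
  have h3 : WithLp.toLp 2 ((0 : H), (0 : K)) = 0 := rfl
  rw [output, state_eq_zero fun α v hv _ => h α v hv, h 1 w (one_mul w).symm, h3, map_zero]
  rfl

-- Translation invariance: an impulse at `β` seen from `α * β` looks like an impulse at `1` seen
-- from `α`, up to one factor `r` per letter of `α`. State and input are kept together so that
-- linearity of `T` applies to the pair.
open Classical in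
theorem state_single_mul (u : K) (α β : FreeMonoid ι) :
    WithLp.toLp 2 (state T r (Pi.single β u) (α * β), (Pi.single β u : FreeMonoid ι → K) (α * β)) =
      ((r : ℂ) ^ α.length) • WithLp.toLp 2 (state T 1 (Pi.single 1 u) α,
        (Pi.single 1 u : FreeMonoid ι → K) α) := by
  -- The power of `r` is harmless on the input: both sides vanish unless `α = 1`, where it equals
  -- `1`.
  have hsingle : ∀ α : FreeMonoid ι, (Pi.single β u : FreeMonoid ι → K) (α * β) =
      ((r : ℂ) ^ α.length) • (Pi.single 1 u : FreeMonoid ι → K) α := by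
    intro α
    by_cases h : α = 1
    · subst h; simp
    · have h' : α * β ≠ β := by
        intro h0
        have := congrArg length h0
        rw [length_mul] at this
        exact h (length_eq_zero.1 (by omega))
      simp [h, h']
  suffices h : state T r (Pi.single β u) (α * β) =
      ((r : ℂ) ^ α.length) • state T 1 (Pi.single 1 u) α by
    rw [h, hsingle]; rfl
  induction α using FreeMonoid.inductionOn' with
  | one =>
    rw [one_mul, state_one, smul_zero]
    refine state_eq_zero fun α v hv hα => ?_
    refine Pi.single_eq_of_ne (fun hvβ => ?_) _
    subst hvβ
    have := congrArg length hv
    rw [length_mul] at this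
    exact hα (length_eq_zero.1 (by omega))
  | of_mul m γ ih =>
    have : WithLp.toLp 2 (state T r (Pi.single β u) (γ * β),
        (Pi.single β u : FreeMonoid ι → K) (γ * β)) =
      ((r : ℂ) ^ γ.length) • WithLp.toLp 2 (state T 1 (Pi.single 1 u) γ,
        (Pi.single 1 u : FreeMonoid ι → K) γ) := by
      rw [ih, hsingle]; rfl
    rw [mul_assoc, state_of_mul, state_of_mul, this, map_smul, length_mul, length_of, pow_add,
      pow_one, Complex.ofReal_one, one_smul, mul_smul]
    rfl

open Classical in
theorem output_single_mul (u : K) (α β : FreeMonoid ι) :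
    output T r (Pi.single β u) (α * β) =
      ((r : ℂ) ^ α.length) • output T 1 (Pi.single 1 u) α := by
  rw [output, state_single_mul, map_smul]
  rfl

open Classical in
theorem output_single_eq_zero (u : K) {w β : FreeMonoid ι} (h : ∀ α, w ≠ α * β) :
    output T r (Pi.single β u) w = 0 := by
  refine output_eq_zero fun α v hv => Pi.single_eq_of_ne (fun hvβ => ?_) _
  subst hvβ
  exact h α hv

/-! ### Point evaluations of the input-output operator -/

/-- The state energy on each level of the tree is bounded but need not decay with the level, hence
the weight. -/
theorem summable_pow_mul_state (hT : ‖T‖ ≤ 1) (hr : |r| ≤ 1)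
    (f : lp (fun _ : FreeMonoid ι => K) 2) {q : ℝ} (hq0 : 0 ≤ q) (hq1 : q < 1) :
    Summable fun w : FreeMonoid ι => q ^ w.length * ‖state T r f w‖ ^ 2 := by
  refine summable_of_sum_le (c := (1 - q)⁻¹ * ‖f‖ ^ 2) (fun w => by positivity) fun S => ?_
  have h := sum_suffixClosure_le S (fun w => q ^ w.length * ‖state T r f w‖ ^ 2) (fun _ => 0)
    (fun w => q * (q ^ w.length * ‖state T r f w‖ ^ 2) + ‖f w‖ ^ 2) (fun w => by positivity)
    (fun s β => by
      have h1 : ∀ m, q ^ (of m * β).length * ‖state T r f (of m * β)‖ ^ 2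
          = q * q ^ β.length * ‖state T r f (of m * β)‖ ^ 2 := by
        intro m
        rw [length_mul, length_of, pow_add, pow_one]
      simp only [h1, ← mul_sum, add_zero]
      have h2 := energy_le hT hr f s β
      have h3 : ∑ m ∈ s, ‖state T r f (of m * β)‖ ^ 2 ≤ ‖state T r f β‖ ^ 2 + ‖f β‖ ^ 2 := by
        have : 0 ≤ ‖output T r f β‖ ^ 2 := by positivity
        linarith
      have h4 : q * q ^ β.length ≤ 1 := mul_le_one₀ hq1.le (by positivity) (pow_le_one₀ hq0 hq1.le)
      calc _ ≤ q * q ^ β.length * (‖state T r f β‖ ^ 2 + ‖f β‖ ^ 2) := by gcongr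
        _ = q * (q ^ β.length * ‖state T r f β‖ ^ 2) + q * q ^ β.length * ‖f β‖ ^ 2 := by ring
        _ ≤ _ := by
          have : q * q ^ β.length * ‖f β‖ ^ 2 ≤ ‖f β‖ ^ 2 :=
            mul_le_of_le_one_left (by positivity) h4
          linarith)
  rw [sum_add_distrib, ← mul_sum] at h
  simp only [sum_const_zero, add_zero, state_one, length_one, pow_zero, norm_zero, ne_eq,
    OfNat.ofNat_ne_zero, not_false_eq_true, zero_pow, mul_zero, zero_add] at h
  have h1 : 0 < 1 - q := by linarith
  have h2 := sum_norm_sq_le_norm_sq f (suffixClosure S)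
  refine (sum_le_sum_of_subset_of_nonneg (subset_suffixClosure S)
    fun w _ _ => by positivity).trans ?_
  rw [inv_mul_eq_div, le_div_iff₀ h1]
  linarith

/-- With `‖ζ‖² < q < 1`, the weighted bound `ab ≤ c⁻¹a² + cb²`, `c = q ^ w.length`, separates the
product: the monomials are summable against `q⁻¹ ^ w.length` and the states against `q ^ w.length`.
-/
theorem summable_monomialAt_mul_inner_state (hT : ‖T‖ ≤ 1) (hr : |r| ≤ 1)
    (f : lp (fun _ : FreeMonoid ι => K) 2) {ζ : CSpace ι} (hζ : ζ ∈ Metric.ball 0 1) (x : H) :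
    Summable fun w => monomialAt ζ w * inner ℂ x (state T r f w) := by
  obtain ⟨q, hq, hq1⟩ := exists_between (norm_sq_lt_one hζ)
  have hq0 : 0 < q := lt_of_le_of_lt (by positivity) hq
  have h1 := summable_norm_monomialAt_sq_mul (ζ := ζ) (c := q⁻¹) (by positivity)
    (by rw [inv_mul_eq_div, div_lt_one hq0]; exact hq)
  have h2 := summable_pow_mul_state hT hr f hq0.le hq1
  refine Summable.of_norm_bounded ((h1.add h2).mul_right ‖x‖) fun w => ?_
  rw [norm_mul]
  have h3 := norm_inner_le_norm (𝕜 := ℂ) x (state T r f w)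
  have h4 : ‖monomialAt ζ w‖ * ‖state T r f w‖ ≤
      q⁻¹ ^ w.length * ‖monomialAt ζ w‖ ^ 2 + q ^ w.length * ‖state T r f w‖ ^ 2 := by
    set a := ‖monomialAt ζ w‖
    set b := ‖state T r f w‖
    set c := q ^ w.length with hc
    have hc0 : 0 < c := by positivity
    rw [inv_pow, ← hc]
    have : 0 ≤ c⁻¹ * (a - c * b) ^ 2 := by positivity
    have h5 : c⁻¹ * (a - c * b) ^ 2 = c⁻¹ * a ^ 2 - 2 * (a * b) + c * b ^ 2 := by
      field_simp
      ring
    have : 0 ≤ a * b := by positivity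
    linarith
  calc _ ≤ ‖monomialAt ζ w‖ * (‖x‖ * ‖state T r f w‖) := by gcongr
    _ = ‖monomialAt ζ w‖ * ‖state T r f w‖ * ‖x‖ := by ring
    _ ≤ _ := by gcongr

theorem hasSum_inner_tens_star {X : Type*} (z : lp (fun _ : X => ℂ) 2) (v : H)
    (y : lp (fun _ : X => H) 2) :
    HasSum (fun m => z m * inner ℂ v (y m)) (inner ℂ (tens (star z) v) y) := by
  have := lp.hasSum_inner (𝕜 := ℂ) (tens (star z) v) y
  simpa [inner_smul_left] using this

open Classical in
/-- The value of the input-output operator at a point where the colligation interpolates. -/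
theorem hasSum_output [CompleteSpace H] [CompleteSpace K] (hT : ‖T‖ ≤ 1)
    {ζ : CSpace ι} (hζ : ζ ∈ Metric.ball 0 1) {x : H} {h h' : K}
    (hadj : adjoint T (WithLp.toLp 2 (tens (star ζ) x, h)) = WithLp.toLp 2 (x, h')) (u : K) :
    HasSum (fun w => inner ℂ h (output T 1 (Pi.single 1 u) w) * monomialAt ζ w)
      (inner ℂ h' u) := by
  set f : lp (fun _ : FreeMonoid ι => K) 2 := lp.single 2 1 u with hf
  have hfc : (f : FreeMonoid ι → K) = Pi.single 1 u := by
    rw [hf]; exact lp.coeFn_single (E := fun _ : FreeMonoid ι => K) 2 1 u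
  set G : FreeMonoid ι → ℂ := fun w => monomialAt ζ w * inner ℂ x (state T 1 f w) with hG
  have hGs : Summable G := summable_monomialAt_mul_inner_state hT (by simp) f hζ x
  obtain ⟨S, hS⟩ := hGs
  -- The relation for `T*`, paired with the state and input at `β` and multiplied by `ζ_β`,
  -- expresses the sum of `G` over the children of `β` through `G β`, the input and the output.
  have hfiber : ∀ β, HasSum (fun m => G (of m * β))
      (G β + monomialAt ζ β * inner ℂ h' (f β)
        - inner ℂ h (output T 1 f β) * monomialAt ζ β) := by
    intro β
    set v := WithLp.toLp 2 (state T 1 f β, f β) with hv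
    have h1 := (hasSum_inner_tens_star ζ x (T v).fst).mul_left (monomialAt ζ β)
    have h2 : inner ℂ (WithLp.toLp 2 (tens (star ζ) x, h)) (T v) =
        inner ℂ (WithLp.toLp 2 (x, h')) v := by
      rw [← adjoint_inner_left, hadj]
    rw [WithLp.prod_inner_apply, WithLp.prod_inner_apply] at h2
    change inner ℂ (tens (star ζ) x) (T v).fst + inner ℂ h (output T 1 f β) =
      inner ℂ x (state T 1 f β) + inner ℂ h' (f β) at h2
    have h3 : G β + monomialAt ζ β * inner ℂ h' (f β)
        - inner ℂ h (output T 1 f β) * monomialAt ζ β =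
        monomialAt ζ β * inner ℂ (tens (star ζ) x) (T v).fst := by
      simp only [hG]
      linear_combination (-monomialAt ζ β) * h2
    rw [h3]
    refine h1.congr_fun fun m => ?_
    simp only [hG, monomialAt_of_mul, state_of_mul, Complex.ofReal_one, one_smul, ← hv]
    ring
  -- The children of all words are all words but the root, where `G` vanishes. So the sum over
  -- children is again `S`, and `S` cancels when the fiber identities are added up.
  have hprod : HasSum (fun p : FreeMonoid ι × ι => G (of p.2 * p.1)) S := by
    have h1 := summable_freeMonoid_cons hS.summable
    have h2 := tsum_freeMonoid hS.summable
    have h3 : G 1 = 0 := by simp [hG]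
    rw [h3, zero_add, hS.tsum_eq] at h2
    have h4 := h1.hasSum
    rw [← h2] at h4
    exact (Equiv.prodComm (FreeMonoid ι) ι).hasSum_iff.2 h4
  have h5 := hprod.prod_fiberwise hfiber
  have h6 : HasSum (fun β => monomialAt ζ β * inner ℂ h' (f β)) (inner ℂ h' u) := by
    have := hasSum_single (f := fun β => monomialAt ζ β * inner ℂ h' (f β)) 1 (by
      intro β hβ
      simp [hfc, hβ])
    simpa [hfc] using this
  have h7 := (hS.add h6).sub h5
  rw [add_sub_cancel_left] at h7
  rw [← hfc]
  exact h7.congr_fun fun β => by ring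

end transfer

end NCPick

end

/-! ### Damped series of creation operators and weak limits -/

noncomputable section

namespace NCPick

open Finset FreeMonoid ComplexConjugate ContinuousLinearMap Filter Topology

section summation

variable {ι : Type*}

/-- The product of creation operators along a word. -/
def creationWord : FreeMonoid ι →* (FockSpace ι →L[ℂ] FockSpace ι) := FreeMonoid.lift creation

theorem creationWord_basisVec (α β : FreeMonoid ι) :
    creationWord α (FockSpace.basisVec β) = FockSpace.basisVec (α * β) := by
  induction α using FreeMonoid.inductionOn' with
  | one => simp
  | of_mul m γ ih =>
    rw [map_mul, mul_assoc, ← creation_basisVec, ← ih]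
    rfl

theorem creationWord_mem (α : FreeMonoid ι) :
    creationWord α ∈ Algebra.adjoin ℂ (Set.range (creation (ι := ι))) := by
  induction α using FreeMonoid.inductionOn' with
  | one => rw [map_one]; exact one_mem _
  | of_mul m γ ih =>
    rw [map_mul]
    exact mul_mem (Algebra.subset_adjoin ⟨m, rfl⟩) ih

theorem adjoint_creation_apply (m : ι) (f : FockSpace ι) (w : FreeMonoid ι) :
    adjoint (creation m) f w = f (of m * w) := by
  rw [← inner_basisVec_left, adjoint_inner_right, creation_basisVec, inner_basisVec_left]

theorem adjoint_creation_comp_self (m : ι) (f : FockSpace ι) :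
    adjoint (creation m) (creation m f) = f := by
  suffices h : adjoint (creation m) ∘L creation m = ContinuousLinearMap.id ℂ (FockSpace ι) from
    congrArg (fun A => A f) h
  refine fockSpace_ext fun β => lp.ext (funext fun w => ?_)
  rw [comp_apply, adjoint_creation_apply, creation_basisVec, ← inner_basisVec_left,
    id_apply, ← inner_basisVec_left]
  classical
  have h := orthonormal_iff_ite.1 (FockSpace.orthonormal_basisVec ι)
  rw [h, h]
  simp

theorem adjoint_creation_comp_of_ne {m l : ι} (hml : m ≠ l) (f : FockSpace ι) :
    adjoint (creation m) (creation l f) = 0 := by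
  suffices h : adjoint (creation m) ∘L creation l = 0 from congrArg (fun A => A f) h
  refine fockSpace_ext fun β => lp.ext (funext fun w => ?_)
  rw [comp_apply, adjoint_creation_apply, creation_basisVec, ← inner_basisVec_left]
  classical
  rw [orthonormal_iff_ite.1 (FockSpace.orthonormal_basisVec ι), if_neg]
  · rfl
  · intro h
    have : m :: toList w = l :: toList β := h
    simp only [List.cons.injEq] at this
    exact hml this.1

/-- The creation operators form a row contraction. -/
theorem sum_norm_adjoint_creation_le (s : Finset ι) (f : FockSpace ι) :
    ∑ m ∈ s, ‖adjoint (creation m) f‖ ^ 2 ≤ ‖f‖ ^ 2 := by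
  -- `g` is the projection of `f` onto the span of the ranges of the `creation m`, `m ∈ s`; thus
  -- `⟨f, g⟩ = ‖g‖² = N`.
  set g := ∑ m ∈ s, creation m (adjoint (creation m) f) with hg
  set N := ∑ m ∈ s, ‖adjoint (creation m) f‖ ^ 2 with hN
  have hN0 : 0 ≤ N := sum_nonneg fun m _ => by positivity
  have h1 : inner ℂ f g = (N : ℂ) := by
    rw [hg, inner_sum, hN]
    push_cast
    refine sum_congr rfl fun m _ => ?_
    rw [← adjoint_inner_left, inner_self_eq_norm_sq_to_K]
    rfl
  have h3 : ∀ m ∈ s, adjoint (creation m) g = adjoint (creation m) f := by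
    intro m hm
    rw [hg, map_sum, sum_eq_single_of_mem m hm]
    · rw [adjoint_creation_comp_self]
    · intro l _ hl
      exact adjoint_creation_comp_of_ne hl.symm _
  have h2 : inner ℂ g g = (N : ℂ) := by
    nth_rw 2 [hg]
    rw [inner_sum, hN]
    push_cast
    refine sum_congr rfl fun m hm => ?_
    rw [← adjoint_inner_left, h3 m hm, inner_self_eq_norm_sq_to_K]
    rfl
  have h4 : ‖g‖ ^ 2 = N := by
    rw [inner_self_eq_norm_sq_to_K] at h2
    have h2' : ((‖g‖ ^ 2 : ℝ) : ℂ) = N := by push_cast; exact h2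
    exact Complex.ofReal_injective h2'
  have h5 : N ≤ ‖f‖ * ‖g‖ := by
    have := norm_inner_le_norm (𝕜 := ℂ) f g
    rwa [h1, Complex.norm_real, Real.norm_of_nonneg hN0] at this
  nlinarith [norm_nonneg f, norm_nonneg g, sq_nonneg (‖f‖ - ‖g‖)]

/-- By the row contraction bound each level contributes at most `q ^ n * ‖f‖²`. Adjoints reverse
products, so the recursion lengthens words on the right; reversing the words turns this into a
recursion on the tree of right factors. -/
theorem sum_pow_mul_adjoint_creationWord_le {q : ℝ} (hq0 : 0 ≤ q) (hq1 : q < 1)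
    (S : Finset (FreeMonoid ι)) (f : FockSpace ι) :
    ∑ α ∈ S, q ^ α.length * ‖adjoint (creationWord α) f‖ ^ 2 ≤ (1 - q)⁻¹ * ‖f‖ ^ 2 := by
  classical
  set p : FreeMonoid ι → ℝ := fun w => q ^ w.length * ‖adjoint (creationWord w.reverse) f‖ ^ 2
  have hp0 : ∀ w, 0 ≤ p w := fun w => by positivity
  have hlen : ∀ w : FreeMonoid ι, w.reverse.length = w.length := fun w => List.length_reverse
  have h := sum_suffixClosure_le (S.image reverse) p (fun _ => 0) (fun w => q * p w) hp0 (by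
    intro s β
    have h1 : ∀ m, p (of m * β) = q * q ^ β.length *
        ‖adjoint (creation m) (adjoint (creationWord β.reverse) f)‖ ^ 2 := by
      intro m
      have h2 : creationWord (of m * β).reverse = creationWord β.reverse ∘L creation m := by
        rw [reverse_mul, map_mul]; rfl
      simp only [p]
      rw [h2, adjoint_comp, comp_apply, length_mul, length_of, pow_add, pow_one]
    simp only [h1, ← mul_sum, add_zero, p]
    rw [← mul_assoc]
    gcongr
    exact sum_norm_adjoint_creation_le s _)
  rw [← mul_sum] at h
  have hp1 : p 1 = ‖f‖ ^ 2 := by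
    have : (1 : FreeMonoid ι).reverse = 1 := rfl
    simp only [p, this, map_one, length_one, pow_zero, one_mul, one_def]
    rw [adjoint_id]; rfl
  simp only [sum_const_zero, add_zero, hp1] at h
  have h3 : ∑ α ∈ S, q ^ α.length * ‖adjoint (creationWord α) f‖ ^ 2 =
      ∑ w ∈ S.image reverse, p w := by
    rw [sum_image (fun a _ b _ hab => by
      simpa using congrArg reverse hab)]
    refine sum_congr rfl fun α _ => ?_
    simp only [p, reverse_reverse, hlen]
  rw [h3]
  refine (sum_le_sum_of_subset_of_nonneg (subset_suffixClosure _) fun w _ _ => hp0 w).trans ?_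
  rw [inv_mul_eq_div, le_div_iff₀ (by linarith)]
  linarith

/-- The triangle inequality would need absolutely summable coefficients. Instead `‖g‖²`, for `g` the
image of `f`, is expanded with adjoints on `g`, and Cauchy–Schwarz groups the powers of `r` with the
adjoints, leaving only the `ℓ²` norm of `c`. -/
theorem norm_sum_creationWord_le {r : ℝ} (hr : |r| < 1) (c : FreeMonoid ι → ℂ)
    (S : Finset (FreeMonoid ι)) :
    ‖∑ α ∈ S, ((r : ℂ) ^ α.length * c α) • creationWord α‖ ≤
      √((1 - r ^ 2)⁻¹ * ∑ α ∈ S, ‖c α‖ ^ 2) := by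
  have hr2 : r ^ 2 < 1 := (sq_lt_one_iff_abs_lt_one r).2 hr
  have hD : 0 < (1 - r ^ 2)⁻¹ := inv_pos.2 (by linarith)
  refine opNorm_le_bound _ (Real.sqrt_nonneg _) fun f => ?_
  set g := (∑ α ∈ S, ((r : ℂ) ^ α.length * c α) • creationWord α) f with hg
  set C := ∑ α ∈ S, ‖c α‖ ^ 2 with hC
  have hC0 : 0 ≤ C := sum_nonneg fun _ _ => by positivity
  have h1 : ‖g‖ ^ 2 ≤ ∑ α ∈ S, ‖c α‖ * (|r| ^ α.length * ‖adjoint (creationWord α) g‖) * ‖f‖ := by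
    have h2 : ((‖g‖ ^ 2 : ℝ) : ℂ) =
        ∑ α ∈ S, (r : ℂ) ^ α.length * c α * inner ℂ (adjoint (creationWord α) g) f := by
      have : ((‖g‖ ^ 2 : ℝ) : ℂ) = inner ℂ g g := by
        rw [inner_self_eq_norm_sq_to_K]; push_cast; rfl
      rw [this]
      nth_rw 2 [hg]
      rw [_root_.sum_apply, inner_sum]
      refine sum_congr rfl fun α _ => ?_
      rw [smul_apply, inner_smul_right, adjoint_inner_left]
    have h3 := congrArg norm h2
    rw [Complex.norm_real, Real.norm_of_nonneg (by positivity)] at h3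
    rw [h3]
    refine (norm_sum_le _ _).trans (sum_le_sum fun α _ => ?_)
    rw [norm_mul, norm_mul, norm_pow, Complex.norm_real, Real.norm_eq_abs]
    have := norm_inner_le_norm (𝕜 := ℂ) (adjoint (creationWord α) g) f
    calc _ ≤ |r| ^ α.length * ‖c α‖ * (‖adjoint (creationWord α) g‖ * ‖f‖) := by gcongr
      _ = _ := by ring
  rw [← sum_mul] at h1
  have h4 := sum_mul_sq_le_sq_mul_sq S (fun α => ‖c α‖)
    (fun α => |r| ^ α.length * ‖adjoint (creationWord α) g‖)
  have h5 : ∑ α ∈ S, (|r| ^ α.length * ‖adjoint (creationWord α) g‖) ^ 2 ≤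
      (1 - r ^ 2)⁻¹ * ‖g‖ ^ 2 := by
    refine le_trans (le_of_eq (sum_congr rfl fun α _ => ?_))
      (sum_pow_mul_adjoint_creationWord_le (sq_nonneg r) hr2 S g)
    rw [mul_pow, ← pow_mul, mul_comm α.length 2, pow_mul, sq_abs]
  set X := ∑ α ∈ S, ‖c α‖ * (|r| ^ α.length * ‖adjoint (creationWord α) g‖)
  have hX0 : 0 ≤ X := sum_nonneg fun _ _ => by positivity
  have h6 : X ^ 2 ≤ C * ((1 - r ^ 2)⁻¹ * ‖g‖ ^ 2) :=
    h4.trans (mul_le_mul_of_nonneg_left h5 hC0)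
  have h7 : X ≤ √((1 - r ^ 2)⁻¹ * C) * ‖g‖ := by
    refine abs_le_of_sq_le_sq' ?_ (by positivity) |>.2
    rw [mul_pow, Real.sq_sqrt (by positivity)]
    linarith
  rcases (norm_nonneg g).eq_or_lt with h0 | h0
  · rw [← h0]; positivity
  · have h8 : ‖g‖ * ‖g‖ ≤ √((1 - r ^ 2)⁻¹ * C) * ‖f‖ * ‖g‖ := by
      calc ‖g‖ * ‖g‖ = ‖g‖ ^ 2 := by ring
        _ ≤ X * ‖f‖ := h1
        _ ≤ √((1 - r ^ 2)⁻¹ * C) * ‖g‖ * ‖f‖ := by gcongr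
        _ = _ := by ring
    exact le_of_mul_le_mul_right h8 h0

theorem summable_creationWord {r : ℝ} (hr : |r| < 1) {c : FreeMonoid ι → ℂ}
    (hc : Summable fun α => ‖c α‖ ^ 2) :
    Summable fun α => ((r : ℂ) ^ α.length * c α) • creationWord α := by
  have hr2 : r ^ 2 < 1 := (sq_lt_one_iff_abs_lt_one r).2 hr
  have hD : 0 < (1 - r ^ 2)⁻¹ := inv_pos.2 (by linarith)
  rw [summable_iff_vanishing_norm]
  intro ε hε
  obtain ⟨s, hs⟩ := summable_iff_vanishing_norm.1 hc (ε ^ 2 / (1 - r ^ 2)⁻¹) (by positivity)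
  refine ⟨s, fun t ht => (norm_sum_creationWord_le hr c t).trans_lt ?_⟩
  have h1 := hs t ht
  rw [Real.norm_of_nonneg (sum_nonneg fun _ _ => by positivity), lt_div_iff₀ hD] at h1
  rw [Real.sqrt_lt' hε, mul_comm]
  exact h1

/-- An operator whose matrix is a damped convolution with a square summable sequence of
coefficients belongs to the noncommutative disc algebra. -/
theorem mem_discAlgebra {r : ℝ} (hr : |r| < 1) {c : FreeMonoid ι → ℂ}
    (hc : Summable fun α => ‖c α‖ ^ 2) {A : FockSpace ι →L[ℂ] FockSpace ι}
    (hA : ∀ α β, A (FockSpace.basisVec β) (α * β) = (r : ℂ) ^ α.length * c α)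
    (hA0 : ∀ w β, (∀ α, w ≠ α * β) → A (FockSpace.basisVec β) w = 0) :
    A ∈ discAlgebra ι := by
  classical
  obtain ⟨B, hB⟩ := summable_creationWord hr hc
  have hAB : A = B := by
    refine fockSpace_ext fun β => lp.ext (funext fun w => ?_)
    have h1 : HasSum (fun α => ((r : ℂ) ^ α.length * c α) *
        inner ℂ (FockSpace.basisVec w) (FockSpace.basisVec (α * β)))
        (inner ℂ (FockSpace.basisVec w) (B (FockSpace.basisVec β))) := by
      have h2 := (hB.mapL (ContinuousLinearMap.apply ℂ (FockSpace ι)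
        (FockSpace.basisVec β))).mapL (innerSL ℂ (FockSpace.basisVec w))
      simpa [creationWord_basisVec, inner_smul_right] using h2
    rw [inner_basisVec_left] at h1
    have horth := orthonormal_iff_ite.1 (FockSpace.orthonormal_basisVec ι)
    refine HasSum.unique ?_ h1
    by_cases hw : ∃ α, w = α * β
    · obtain ⟨α, rfl⟩ := hw
      rw [hA]
      convert hasSum_single α ?_ using 1
      · rw [horth]; simp
      · intro γ hγ
        rw [horth, if_neg, mul_zero]
        exact fun h => hγ (mul_right_cancel h).symm
    · push Not at hw
      rw [hA0 w β hw]
      refine hasSum_zero.congr_fun fun α => ?_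
      rw [horth, if_neg (hw α), mul_zero]
  rw [hAB]
  refine mem_closure_of_tendsto hB (Eventually.of_forall fun S => ?_)
  exact sum_mem fun α _ => Subalgebra.smul_mem _ (creationWord_mem α) _

/-- Uniform boundedness gives equicontinuity, so the set of vectors where convergence holds is
closed; it contains all finite combinations of basis vectors. -/
theorem tendsto_of_tendsto_basisVec {φ : ℕ → FockSpace ι →L[ℂ] ℂ} {ψ : FockSpace ι →L[ℂ] ℂ}
    {C : ℝ} (hC : ∀ n, ‖φ n‖ ≤ C)
    (h : ∀ w, Tendsto (fun n => φ n (FockSpace.basisVec w)) atTop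
      (𝓝 (ψ (FockSpace.basisVec w)))) (f : FockSpace ι) :
    Tendsto (fun n => φ n f) atTop (𝓝 (ψ f)) := by
  classical
  have hlip : ∀ n, LipschitzWith C.toNNReal (φ n) := fun n =>
    (φ n).lipschitz.weaken (NNReal.le_toNNReal_of_coe_le (hC n))
  have hequi : Equicontinuous fun n => (φ n : FockSpace ι → ℂ) :=
    (LipschitzWith.uniformEquicontinuous _ _ hlip).equicontinuous
  have hclosed : IsClosed {x | Tendsto (fun n => φ n x) atTop (𝓝 (ψ x))} :=
    hequi.isClosed_setOfPred_tendsto ψ.continuous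
  refine hclosed.mem_of_tendsto (lp.hasSum_single (by norm_num) f) (Eventually.of_forall fun S => ?_)
  simp only [Set.mem_ofPred_eq, map_sum]
  refine tendsto_finsetSum _ fun w _ => ?_
  have h1 : lp.single 2 w (f w) = f w • FockSpace.basisVec w := by
    rw [FockSpace.basisVec, ← lp.single_smul, smul_eq_mul, mul_one]
  rw [h1]
  simp only [map_smul]
  exact (h w).const_smul (f w)

/-- Bounded entrywise convergence implies convergence in the weak operator topology. -/
theorem tendsto_inner_of_tendsto_entries {A : ℕ → FockSpace ι →L[ℂ] FockSpace ι}
    {B : FockSpace ι →L[ℂ] FockSpace ι} (hA : ∀ n, ‖A n‖ ≤ 1)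
    (h : ∀ β w, Tendsto (fun n => A n (FockSpace.basisVec β) w) atTop
      (𝓝 (B (FockSpace.basisVec β) w))) (f g : FockSpace ι) :
    Tendsto (fun n => inner ℂ g (A n f)) atTop (𝓝 (inner ℂ g (B f))) := by
  have h1 : ∀ w, Tendsto (fun n => inner ℂ (FockSpace.basisVec w) (A n f)) atTop
      (𝓝 (inner ℂ (FockSpace.basisVec w) (B f))) := by
    intro w
    refine tendsto_of_tendsto_basisVec (φ := fun n => innerSL ℂ (FockSpace.basisVec w) ∘L A n)
      (ψ := innerSL ℂ (FockSpace.basisVec w) ∘L B) (C := ‖FockSpace.basisVec w‖) (fun n => ?_)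
      (fun β => ?_) f
    · refine (opNorm_comp_le _ _).trans ?_
      rw [innerSL_apply_norm]
      exact mul_le_of_le_one_right (norm_nonneg _) (hA n)
    · simpa [inner_basisVec_left] using h β w
  -- The same density argument in the other vector, after a conjugation that makes the dependence on
  -- `g` linear.
  have h2 := tendsto_of_tendsto_basisVec (φ := fun n => innerSL ℂ (A n f)) (ψ := innerSL ℂ (B f))
    (C := ‖f‖) (fun n => by
      rw [innerSL_apply_norm]
      simpa using (A n).le_of_opNorm_le (hA n) f) (fun w => by
      have := (Complex.continuous_conj.tendsto _).comp (h1 w)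
      simpa [Function.comp_def, inner_conj_symm] using this) g
  have h3 := (Complex.continuous_conj.tendsto _).comp h2
  simpa [Function.comp_def, inner_conj_symm] using h3

theorem mem_toeplitzAlgebra_of_tendsto {A : ℕ → FockSpace ι →L[ℂ] FockSpace ι}
    {B : FockSpace ι →L[ℂ] FockSpace ι} (hA : ∀ n, ‖A n‖ ≤ 1) (hmem : ∀ n, A n ∈ discAlgebra ι)
    (h : ∀ β w, Tendsto (fun n => A n (FockSpace.basisVec β) w) atTop
      (𝓝 (B (FockSpace.basisVec β) w))) : B ∈ toeplitzAlgebra ι := by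
  refine mem_closure_of_tendsto (f := fun n => WOTofCLM (A n)) (b := atTop) ?_
    (Eventually.of_forall fun n => ⟨A n, hmem n, rfl⟩)
  rw [ContinuousLinearMapWOT.tendsto_iff_forall_dual_apply_tendsto]
  intro f y
  obtain ⟨g, rfl⟩ := (InnerProductSpace.toDual ℂ (FockSpace ι)).surjective y
  exact tendsto_inner_of_tendsto_entries hA h f g

end summation

end NCPick

end

/-! ### The lurking isometry -/

noncomputable section

namespace NCPick

open Finset FreeMonoid ComplexConjugate ContinuousLinearMap Filter Topology

/-- A map dominated in norm by another one factors through it by a contraction. -/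
theorem exists_contraction {E G₁ G₂ : Type*} [AddCommGroup E] [Module ℂ E]
    [NormedAddCommGroup G₁] [InnerProductSpace ℂ G₁] [CompleteSpace G₁]
    [NormedAddCommGroup G₂] [InnerProductSpace ℂ G₂] [CompleteSpace G₂]
    (L₁ : E →ₗ[ℂ] G₁) (L₂ : E →ₗ[ℂ] G₂) (h : ∀ x, ‖L₂ x‖ ≤ ‖L₁ x‖) :
    ∃ V : G₁ →L[ℂ] G₂, ‖V‖ ≤ 1 ∧ ∀ x, V (L₁ x) = L₂ x := by
  set M := (LinearMap.range L₁).topologicalClosure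
  have : CompleteSpace M := (Submodule.isClosed_topologicalClosure _).completeSpace_coe
  have hM : ∀ x, L₁ x ∈ M := fun x => Submodule.le_topologicalClosure _ (LinearMap.mem_range_self L₁ x)
  set L := L₁.codRestrict M hM
  have hdense : DenseRange L := by
    intro y
    rw [closure_subtype]
    have : Subtype.val '' Set.range L = (LinearMap.range L₁ : Set G₁) := by
      rw [← Set.range_comp]; rfl
    rw [this]
    exact y.2
  have hle : ∀ x, ‖L₂ x‖ ≤ 1 * ‖L x‖ := fun x => by rw [one_mul]; exact h x
  -- The induced map on the closure of the range of `L₁` is extended by zero on the orthogonal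
  -- complement.
  refine ⟨L₂.extendOfNorm L ∘L M.orthogonalProjectionOnto, ?_, fun x => ?_⟩
  · refine (opNorm_comp_le _ _).trans ?_
    exact mul_le_one₀ (LinearMap.opNorm_extendOfNorm_le hdense zero_le_one hle) (norm_nonneg _)
      M.orthogonalProjectionOnto_norm_le
  · have : M.orthogonalProjectionOnto (L₁ x) = L x :=
      Submodule.orthogonalProjectionOnto_mem_subspace_eq_self (L x)
    rw [comp_apply, this]
    exact LinearMap.extendOfNorm_eq hdense ⟨1, hle⟩ x

theorem exists_inner_eq_of_isPositive {H : Type*} [NormedAddCommGroup H] [InnerProductSpace ℂ H]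
    [CompleteSpace H] {P : H →L[ℂ] H} (h : P.IsPositive) :
    ∃ Q : H →L[ℂ] H, ∀ x y, inner ℂ (Q x) (Q y) = inner ℂ (P x) y := by
  have h0 : 0 ≤ P := (nonneg_iff_isPositive P).2 h
  have h1 : IsSelfAdjoint (CFC.sqrt P) := (CFC.sqrt_nonneg P).isSelfAdjoint
  refine ⟨CFC.sqrt P, fun x y => ?_⟩
  rw [← adjoint_inner_left, ← star_eq_adjoint, h1.star_eq, ← comp_apply, ← ContinuousLinearMap.mul_def,
    CFC.sqrt_mul_sqrt_self P h0]

section realization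

/-- The inclusion of the `i`-th summand into `K^k`. -/
def blockSingle (K : Type*) [NormedAddCommGroup K] [InnerProductSpace ℂ K] {k : ℕ} (i : Fin k) :
    K →L[ℂ] PiLp 2 (fun _ : Fin k => K) :=
  ((PiLp.continuousLinearEquiv 2 ℂ (fun _ : Fin k => K)).symm :
      (Fin k → K) →L[ℂ] PiLp 2 (fun _ : Fin k => K)) ∘L
    ContinuousLinearMap.single ℂ (fun _ : Fin k => K) i

theorem blockSingle_apply {K : Type*} [NormedAddCommGroup K] [InnerProductSpace ℂ K] {k : ℕ}
    (i : Fin k) (h : K) (j : Fin k) :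
    blockSingle K i h j = (Pi.single i h : Fin k → K) j := rfl

variable {ι K : Type*} [NormedAddCommGroup K] [InnerProductSpace ℂ K] [CompleteSpace K] {k : ℕ}

theorem inner_pick_blockSingle (lam : Fin k → CSpace ι) (W : Fin k → (K →L[ℂ] K)) (i j : Fin k)
    (h h' : K) :
    inner ℂ (blockOperator (pickMatrix lam W) (blockSingle K i h)) (blockSingle K j h') =
      (1 - inner ℂ (lam j) (lam i))⁻¹ *
        (inner ℂ h h' - inner ℂ (adjoint (W i) h) (adjoint (W j) h')) := by
  rw [inner_blockOperator_pickMatrix, sum_eq_single j, sum_eq_single i]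
  · simp [blockSingle_apply]
  · intro l _ hl
    simp [blockSingle_apply, hl]
  · simp
  · intro l _ hl
    simp [blockSingle_apply, hl]
  · simp

/-- The map `h ↦ (A h, B h)` into the Hilbert sum of two spaces. -/
def pairL {G₁ G₂ : Type*} [NormedAddCommGroup G₁] [InnerProductSpace ℂ G₁]
    [NormedAddCommGroup G₂] [InnerProductSpace ℂ G₂] (A : K →L[ℂ] G₁) (B : K →L[ℂ] G₂) :
    K →L[ℂ] WithLp 2 (G₁ × G₂) :=
  ((WithLp.prodContinuousLinearEquiv 2 ℂ G₁ G₂).symm : (G₁ × G₂) →L[ℂ] WithLp 2 (G₁ × G₂)) ∘L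
    A.prod B

theorem inner_star_star {X : Type*} (z z' : lp (fun _ : X => ℂ) 2) :
    inner ℂ (star z) (star z') = inner ℂ z' z := by
  rw [lp.inner_eq_tsum, lp.inner_eq_tsum]
  refine tsum_congr fun m => ?_
  simp [RCLike.inner_apply, mul_comm]

/-- A positive Pick matrix yields a contractive colligation that interpolates the data. -/
theorem exists_colligation (lam : Fin k → CSpace ι) (hlam : ∀ j, lam j ∈ Metric.ball 0 1)
    (W : Fin k → (K →L[ℂ] K)) (hpos : (blockOperator (pickMatrix lam W)).IsPositive) :
    ∃ (T : Colligation ι (PiLp 2 (fun _ : Fin k => K)) K)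
      (θ : Fin k → K → PiLp 2 (fun _ : Fin k => K)), ‖T‖ ≤ 1 ∧
      ∀ j h, adjoint T (WithLp.toLp 2 (tens (star (lam j)) (θ j h), h)) =
        WithLp.toLp 2 (θ j h, adjoint (W j) h) := by
  obtain ⟨Q, hQ⟩ := exists_inner_eq_of_isPositive hpos
  set θ : Fin k → K →L[ℂ] PiLp 2 (fun _ : Fin k => K) := fun i => Q ∘L blockSingle K i with hθ
  have hθin : ∀ i j h h', (1 - inner ℂ (lam j) (lam i)) * inner ℂ (θ i h) (θ j h') =
      inner ℂ h h' - inner ℂ (adjoint (W i) h) (adjoint (W j) h') := by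
    intro i j h h'
    rw [hθ, comp_apply, comp_apply, hQ, inner_pick_blockSingle,
      mul_inv_cancel_left₀ (one_sub_inner_ne_zero (hlam i) (hlam j))]
  set A : Fin k → K →L[ℂ] _ := fun i =>
    pairL (tensLeft (star (lam i)) ∘L θ i) (ContinuousLinearMap.id ℂ K) with hA
  set B : Fin k → K →L[ℂ] _ := fun i => pairL (θ i) (adjoint (W i)) with hB
  -- This is `hθin` with the negative terms moved across, so that each side becomes a Gram matrix.
  -- Conjugating the points in `A` puts `⟨λ_j, λ_i⟩` in the right order.
  have hAB : ∀ i j h h', inner ℂ (A i h) (A j h') = inner ℂ (B i h) (B j h') := by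
    intro i j h h'
    rw [WithLp.prod_inner_apply, WithLp.prod_inner_apply]
    change inner ℂ (tens (star (lam i)) (θ i h)) (tens (star (lam j)) (θ j h')) + inner ℂ h h' =
      inner ℂ (θ i h) (θ j h') + inner ℂ (adjoint (W i) h) (adjoint (W j) h')
    rw [inner_tens, inner_star_star]
    linear_combination (-1 : ℂ) * hθin i j h h'
  set L₁ := ∑ i, A i ∘L PiLp.proj 2 (fun _ : Fin k => K) i with hL₁
  set L₂ := ∑ i, B i ∘L PiLp.proj 2 (fun _ : Fin k => K) i with hL₂
  have hL₁x : ∀ x, L₁ x = ∑ i, A i (x i) := fun x => by rw [hL₁, _root_.sum_apply]; rfl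
  have hL₂x : ∀ x, L₂ x = ∑ i, B i (x i) := fun x => by rw [hL₂, _root_.sum_apply]; rfl
  have hnorm : ∀ x, ‖L₂ x‖ ≤ ‖L₁ x‖ := by
    intro x
    have : inner ℂ (L₂ x) (L₂ x) = inner ℂ (L₁ x) (L₁ x) := by
      rw [hL₁x, hL₂x]
      simp only [inner_sum, sum_inner, hAB]
    rw [norm_eq_sqrt_re_inner (𝕜 := ℂ), norm_eq_sqrt_re_inner (𝕜 := ℂ) (L₁ x), this]
  obtain ⟨V, hV, hVL⟩ := exists_contraction L₁.toLinearMap L₂.toLinearMap hnorm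
  refine ⟨adjoint V, fun j h => θ j h, by rwa [LinearIsometryEquiv.norm_map], fun j h => ?_⟩
  rw [adjoint_adjoint]
  have h1 := hVL (blockSingle K j h)
  rw [ContinuousLinearMap.coe_coe, ContinuousLinearMap.coe_coe, hL₁x, hL₂x] at h1
  rw [sum_eq_single j (fun l _ hl => by simp [blockSingle_apply, hl]) (by simp),
    sum_eq_single j (fun l _ hl => by simp [blockSingle_apply, hl]) (by simp)] at h1
  simp only [blockSingle_apply, Pi.single_eq_same] at h1
  exact h1

end realization

/-! ### From the input-output operator to an element of `M_γ(F^∞)` -/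

section multiplier

variable {ι I K H : Type*} [NormedAddCommGroup K] [InnerProductSpace ℂ K]
  [NormedAddCommGroup H] [InnerProductSpace ℂ H]

/-- The isometry `h ↦ h ⊗ e_β` from `K` into `⊕_I F²`. -/
def basisTensIsometry (e : HilbertBasis I ℂ K) (β : FreeMonoid ι) :
    K →ₗᵢ[ℂ] Ampliation I (FockSpace ι) :=
  LinearMap.isometryOfInner (basisTens e (FockSpace.basisVec β) : K →ₗ[ℂ] _) fun h h' => by
    rw [ContinuousLinearMap.coe_coe, inner_basisTens, inner_self_eq_norm_sq_to_K,
      (FockSpace.orthonormal_basisVec ι).norm_eq_one]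
    simp

theorem orthogonalFamily_basisTens (e : HilbertBasis I ℂ K) :
    OrthogonalFamily ℂ (fun _ : FreeMonoid ι => K) (basisTensIsometry e) := by
  intro α β hαβ h h'
  change inner ℂ (basisTens e _ h) (basisTens e _ h') = 0
  rw [inner_basisTens, (FockSpace.orthonormal_basisVec ι).inner_eq_zero hαβ, mul_zero]

/-- The identification of `ℓ²(𝔽⁺, K)` with a subspace of `⊕_I F²` given by a basis of `K`. -/
def fockTens (e : HilbertBasis I ℂ K) :
    lp (fun _ : FreeMonoid ι => K) 2 →ₗᵢ[ℂ] Ampliation I (FockSpace ι) :=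
  (orthogonalFamily_basisTens e).linearIsometry

theorem fockTens_single [DecidableEq (FreeMonoid ι)] [DecidableEq I] (e : HilbertBasis I ℂ K)
    (β : FreeMonoid ι) (b : I) :
    fockTens e (lp.single 2 β (e b)) = lp.single 2 b (FockSpace.basisVec β) := by
  rw [fockTens, OrthogonalFamily.linearIsometry_apply_single]
  exact basisTens_basis e _ b

variable [CompleteSpace K] {T : Colligation ι H K} {r : ℝ}

/-- The operator on `⊕_I F²` induced by the input-output operator of a colligation. -/
def multiplier (e : HilbertBasis I ℂ K) (hT : ‖T‖ ≤ 1) (hr : |r| ≤ 1) :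
    Ampliation I (FockSpace ι) →L[ℂ] Ampliation I (FockSpace ι) :=
  (fockTens e).toContinuousLinearMap ∘L transfer hT hr ∘L
    adjoint (fockTens e).toContinuousLinearMap

theorem norm_multiplier_le (e : HilbertBasis I ℂ K) (hT : ‖T‖ ≤ 1) (hr : |r| ≤ 1) :
    ‖multiplier e hT hr‖ ≤ 1 := by
  have h1 : ‖(fockTens (ι := ι) e).toContinuousLinearMap‖ ≤ 1 :=
    (fockTens e).norm_toContinuousLinearMap_le
  have h2 : ‖adjoint (fockTens (ι := ι) e).toContinuousLinearMap‖ ≤ 1 := by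
    rwa [LinearIsometryEquiv.norm_map]
  refine (opNorm_comp_le _ _).trans (mul_le_one₀ h1 (norm_nonneg _) ?_)
  exact (opNorm_comp_le _ _).trans (mul_le_one₀ (norm_transfer_le hT hr) (norm_nonneg _) h2)

open Classical in
theorem entry_multiplier (e : HilbertBasis I ℂ K) (hT : ‖T‖ ≤ 1) (hr : |r| ≤ 1) (a b : I)
    (β w : FreeMonoid ι) :
    entry (multiplier e hT hr) a b (FockSpace.basisVec β) w =
      inner ℂ (e a) (output T r (Pi.single β (e b)) w) := by
  have hadj : ∀ f, adjoint (fockTens (ι := ι) e).toContinuousLinearMap (fockTens e f) = f :=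
    fun f => congrArg (fun A => A f) (fockTens (ι := ι) e).adjoint_comp_self
  rw [← inner_basisVec_left, ← inner_single_apply_single, ← fockTens_single e w a,
    ← fockTens_single e β b]
  rw [multiplier, comp_apply, comp_apply, hadj, LinearIsometry.coe_toContinuousLinearMap,
    LinearIsometry.inner_map_map, lp.inner_single_left, transfer_apply, lp.coeFn_single]

theorem norm_entry_le (X : Ampliation I H →L[ℂ] Ampliation I H) (a b : I) :
    ‖entry X a b‖ ≤ ‖X‖ := by
  classical
  refine opNorm_le_bound _ X.opNorm_nonneg fun g => ?_
  refine (lp.norm_apply_le_norm (by norm_num) _ a).trans ((X.le_opNorm _).trans_eq ?_)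
  exact congrArg (‖X‖ * ·) (lp.norm_single (E := fun _ : I => H) (p := 2) (by norm_num) b g)

/-- The multipliers damped by `r = n / (n + 1)` are contractions with entries in the disc algebra,
and their matrix coefficients `r ^ α.length * c α` tend to the undamped ones. -/
theorem multiplier_mem (e : HilbertBasis I ℂ K) (hT : ‖T‖ ≤ 1) :
    multiplier e hT (r := 1) (by simp) ∈ matrixOver I (toeplitzAlgebra ι) := by
  classical
  intro a b
  have hr : ∀ n : ℕ, |(n / (n + 1) : ℝ)| < 1 := by
    intro n
    rw [abs_of_nonneg (by positivity), div_lt_one (by positivity)]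
    linarith
  set c : FreeMonoid ι → ℂ := fun α => inner ℂ (e a) (output T 1 (Pi.single 1 (e b)) α) with hc
  -- The `c α` are the coordinates of the vector to which the undamped entry sends `e_1`.
  have hcs : Summable fun α => ‖c α‖ ^ 2 := by
    have := summable_norm_sq (entry (multiplier e hT (r := 1) (by simp)) a b
      (FockSpace.basisVec (1 : FreeMonoid ι)))
    simpa only [entry_multiplier] using this
  have hmul : ∀ (s : ℝ) (hs : |s| ≤ 1) (α β : FreeMonoid ι),
      entry (multiplier e hT hs) a b (FockSpace.basisVec β) (α * β) =
        (s : ℂ) ^ α.length * c α := by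
    intro s hs α β
    rw [entry_multiplier, output_single_mul, inner_smul_right]
  have hzero : ∀ (s : ℝ) (hs : |s| ≤ 1) (w β : FreeMonoid ι), (∀ α, w ≠ α * β) →
      entry (multiplier e hT hs) a b (FockSpace.basisVec β) w = 0 := by
    intro s hs w β hw
    rw [entry_multiplier, output_single_eq_zero _ hw, inner_zero_right]
  refine mem_toeplitzAlgebra_of_tendsto
    (A := fun n : ℕ => entry (multiplier e hT (hr n).le) a b)
    (fun n => (norm_entry_le _ a b).trans (norm_multiplier_le e hT _))
    (fun n => mem_discAlgebra (hr n) hcs (hmul _ _) (hzero _ _)) fun β w => ?_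
  by_cases hw : ∃ α, w = α * β
  · obtain ⟨α, rfl⟩ := hw
    simp only [hmul]
    have h1 : Tendsto (fun n : ℕ => (n / (n + 1) : ℝ)) atTop (𝓝 1) :=
      tendsto_natCast_div_add_atTop 1
    have h2 := (Complex.continuous_ofReal.tendsto _).comp h1
    exact (h2.pow α.length).mul_const (c α)
  · push Not at hw
    simp only [hzero _ _ w β hw]
    exact tendsto_const_nhds

theorem hasOperatorValueAt_multiplier [CompleteSpace H] (e : HilbertBasis I ℂ K) (hT : ‖T‖ ≤ 1)
    {ζ : CSpace ι} (hζ : ζ ∈ Metric.ball 0 1) {W : K →L[ℂ] K} {θ : K → H}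
    (hadj : ∀ h, adjoint T (WithLp.toLp 2 (tens (star ζ) (θ h), h)) =
      WithLp.toLp 2 (θ h, adjoint W h)) :
    HasOperatorValueAt e (multiplier e hT (r := 1) (by simp)) ζ W := by
  classical
  intro a b
  have h := hasSum_output hT hζ (hadj (e a)) (e b)
  rw [adjoint_inner_left] at h
  refine h.congr_fun fun w => ?_
  rw [entry_multiplier]

end multiplier

end NCPick

end

theorem theorem2p4 {ι : Type*} [Countable ι] [Nonempty ι]
    {K : Type*} [NormedAddCommGroup K] [InnerProductSpace ℂ K] [CompleteSpace K]
    {I : Type*} (e : HilbertBasis I ℂ K)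
    {k : ℕ} (lam : Fin k → NCPick.CSpace ι) (hlam : ∀ j, lam j ∈ Metric.ball 0 1)
    (hdist : Function.Injective lam) (W : Fin k → (K →L[ℂ] K)) :
    (∃ Φ ∈ NCPick.matrixOver I (NCPick.toeplitzAlgebra ι),
        ‖Φ‖ ≤ 1 ∧ ∀ j, NCPick.HasOperatorValueAt e Φ (lam j) (W j)) ↔
      (NCPick.blockOperator (NCPick.pickMatrix lam W)).IsPositive := by
  constructor
  · rintro ⟨Φ, hΦ, hnorm, hW⟩
    exact NCPick.isPositive_of_exists e lam hlam W hΦ hnorm hW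
  · intro hpos
    obtain ⟨T, θ, hT, hadj⟩ := NCPick.exists_colligation lam hlam W hpos
    exact ⟨NCPick.multiplier e hT (r := 1) (by simp), NCPick.multiplier_mem e hT,
      NCPick.norm_multiplier_le e hT _,
      fun j => NCPick.hasOperatorValueAt_multiplier e hT (hlam j) (hadj j)⟩
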